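/- **Quantum decision maker.** Let $\mathcal X=\{1,2\}$, let $\mathcal A$ be a finite set of actions, and let $\alpha\in(0,1]$, $\lambda\ge 0$, $\phi\in[0,1]$. Let $u(a\mid x)\ge 0$ be utilities such that for each $x$ some $u(a\mid x)>0$, and let $\rho_0$ be a density operator on $\mathbb C^{\mathcal X}\otimes\mathbb C^{\mathcal A}$ (basis vectors $|m\rangle$, $m\in\mathcal X\times\mathcal A$). Put $p(a\mid x)=u(a\mid x)^\lambda/\sum_b u(b\mid x)^\lambda$. For a probability vector $\eta$ on $\mathcal X$ define real matrices by $$\Pi_{(x,a),(x',a')}=\mathbf 1_{x=x'}\,p(a'\mid x),\qquad B^\eta_{(x,a),(x',a')}=\mathbf 1_{a=a'}\,\eta(x'),\qquad C=(1-\phi)\Pi^T+\phi (B^\eta)^T ,$$ let $H_{(x,a),(x',a')}=\mathbf 1_{x=x'}$ and $L_{mn}=|m\rangle\langle n|$, and let $\rho_t$ solve, with initial value $\rho_0$, $$\dot\rho=-i(1-\alpha)[H,\rho]+\alpha\sum_{m,n}C_{mn}\Big(L_{mn}\rho L_{mn}^\dagger-\tfrac12\{L_{mn}^\dagger L_{mn},\rho\}\Big).$$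 With $P_a=I\otimes|a\rangle\langle a|$, the steady-state action distribution is $\Gamma^\eta(a)=\lim_{t\to\infty}\operatorname{Tr}(P_a\rho_tP_a^\dagger)$. **Protocol.** Let $p\in[0,1)$, $d>0$, $f\ge0$, let $B_{1,\cdot},B_{2,\cdot}$ be probability densities on an observation space $\mathcal Y$ with reference measure $dy$, and let $\mathbf P=\begin{pmatrix}1&0\\1-p&p\end{pmatrix}$. Beliefs are vectors $\pi=(\pi(1),\pi(2))$ in the unit simplex. Put $$T(\pi,y)=\frac{B_y\mathbf P'\pi}{\mathbf 1'B_y\mathbf P'\pi},\quad B_y=\operatorname{diag}(B_{1,y},B_{2,y}),\qquad R_{x,\pi}(a)=\int_{\mathcal Y}\Gamma^{T(\pi,y)}(a)\,B_{x,y}\,dy,$$ $$R_\pi(a)=\operatorname{diag}(R_{1,\pi}(a),R_{2,\pi}(a)),\qquad \bar\sigma(\pi,a)=\mathbf 1'R_\pi(a)\mathbf P'\pi,\qquad \bar T(\pi,a)=\frac{R_\pi(a)\mathbf P'\pi}{\bar\sigma(\pi,a)} .$$ Start from a belief $\pi_0=\pi$. The state of nature $x_n\in\{1,2\}$ is a Markov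 chain with transition matrix $\mathbf P$ and initial law $\pi$, and $\tau^0=\inf\{n\ge 0:x_n=1\}$. At each time $n\ge1$, given the past, a sensor draws $y_n$ from the density $B_{x_n,\cdot}$, the human draws the action $a_n$ from $\Gamma^{\eta_n}$ with $\eta_n=T(\pi_{n-1},y_n)$, and the detector, which sees only the actions, updates $\pi_n=\bar T(\pi_{n-1},a_n)$. A policy chooses $u_n\in\{1\ (\text{stop and announce}),2\ (\text{continue})\}$, $n\ge 0$, as a function of $a_1,\dots,a_n$. It announces at $\tau=\inf\{n:u_n=1\}$ and has the Kolmogorov–Shiryaev cost $$J_u(\pi)=d\,\mathbb E_\pi[(\tau-\tau^0)^+]+f\,\mathbb P_\pi(\tau<\tau^0).$$ Let $V(\pi)=\inf_uJ_u(\pi)$ over all policies, $Q(\pi,1)=f\pi(2)$ and $Q(\pi,2)=d\pi(1)+\sum_aV(\bar T(\pi,a))\,\bar\sigma(\pi,a)$. Let $\mu^*(\pi)=1$ if $Q(\pi,1)\le Q(\pi,2)$ and $\mu^*(\pi)=2$ otherwise. A stationary policy $u_n=\mu(\pi_n)$ is called optimal if its cost from $\pi$ equals $V(\pi)$ for every belief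 $\pi$. **Theorem.** The limits $\Gamma^\eta(a)$ exist for every probability vector $\eta$ on $\mathcal X$ and every $a\in\mathcal A$. The stationary policy $\mu^*$ is optimal, and there is a single threshold $\pi'\in[0,1]$ such that for every belief $\pi$ $$\mu^*(\pi)=\begin{cases}2,&\pi(1)<\pi',\\1,&\pi(1)\ge\pi'.\end{cases}$$ Moreover every optimal stationary policy agrees with $\mu^*$ at every belief with $\pi(1)\neq\pi'$. -/

import Mathlib

open MeasureTheory Filter Topology
open scoped ENNReal Matrix ComplexOrder

/-! ### The quantum (Lindbladian) decision maker -/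

/-- A human decision maker with state space `X` and action space `A`: the psychological parameters
`(alpha, lam, phi)`, the utility function `u` and the initial psychological state `rho0`,
a density operator on `ℂ^X ⊗ ℂ^A`. -/
structure QuantumAgent (X A : Type*) [Fintype X] [Fintype A] where
  alpha : ℝ
  lam : ℝ
  phi : ℝ
  u : A → X → ℝ
  rho0 : Matrix (X × A) (X × A) ℂ
  alpha_pos : 0 < alpha
  alpha_le_one : alpha ≤ 1
  lam_nonneg : 0 ≤ lam
  phi_nonneg : 0 ≤ phi
  phi_le_one : phi ≤ 1
  u_nonneg : ∀ a x, 0 ≤ u a x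
  exists_u_pos : ∀ x, ∃ a, 0 < u a x
  rho0_posSemidef : rho0.PosSemidef
  rho0_trace : rho0.trace = 1

namespace QuantumAgent

variable {X A : Type*} [Fintype X] [DecidableEq X] [Fintype A] [DecidableEq A]

/-- `p(a | x) = u(a | x)^lam / ∑_b u(b | x)^lam`. -/
noncomputable def choiceProb (M : QuantumAgent X A) (a : A) (x : X) : ℝ :=
  M.u a x ^ M.lam / ∑ b, M.u b x ^ M.lam

/-- `Π(lam)`: block diagonal, every row of the block of `x` being `(p(a | x))_a`. -/
noncomputable def choiceMatrix (M : QuantumAgent X A) : Matrix (X × A) (X × A) ℝ :=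
  Matrix.of fun i j => if i.1 = j.1 then M.choiceProb j.2 i.1 else 0

/-- The belief matrix `B = (η(1) ⋯ η(n)) ⊗ (1 ⋯ 1)ᵀ ⊗ I`. -/
def beliefMatrix (η : X → ℝ) : Matrix (X × A) (X × A) ℝ :=
  Matrix.of fun i j => if i.2 = j.2 then η j.1 else 0

/-- The cognitive matrix `C(lam, phi) = (1 - phi) Πᵀ + phi Bᵀ`; its entries are the rates. -/
noncomputable def cognitiveMatrix (M : QuantumAgent X A) (η : X → ℝ) :
    Matrix (X × A) (X × A) ℝ :=
  (1 - M.phi) • M.choiceMatrixᵀ + M.phi • (beliefMatrix η)ᵀ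

/-- The Hamiltonian: block diagonal, one all-ones block for each state of nature. -/
def hamiltonian : Matrix (X × A) (X × A) ℂ :=
  Matrix.of fun i j => if i.1 = j.1 then 1 else 0

/-- The jump operator `|m⟩⟨n|`. -/
def jump (m n : X × A) : Matrix (X × A) (X × A) ℂ := Matrix.single m n 1

/-- The right-hand side of the Lindblad equation at `ρ`. -/
noncomputable def lindbladRHS (M : QuantumAgent X A) (η : X → ℝ)
    (ρ : Matrix (X × A) (X × A) ℂ) : Matrix (X × A) (X × A) ℂ :=
  (-(Complex.I * (1 - (M.alpha : ℂ)))) • (hamiltonian * ρ - ρ * hamiltonian)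
    + (M.alpha : ℂ) • ∑ m, ∑ n, (M.cognitiveMatrix η m n : ℂ) •
        (jump m n * ρ * (jump m n)ᴴ
          - (1 / 2 : ℂ) • ((jump m n)ᴴ * jump m n * ρ + ρ * ((jump m n)ᴴ * jump m n)))

/-- The Lindbladian as a linear map on operators. -/
noncomputable def lindbladian (M : QuantumAgent X A) (η : X → ℝ) :
    Matrix (X × A) (X × A) ℂ →ₗ[ℂ] Matrix (X × A) (X × A) ℂ where
  toFun := M.lindbladRHS η
  map_add' ρ σ := by
    have h : ∀ (c : ℂ) (a b e a' b' e' : Matrix (X × A) (X × A) ℂ),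
        c • (a + a' - (1 / 2 : ℂ) • (b + b' + (e + e')))
          = c • (a - (1 / 2 : ℂ) • (b + e)) + c • (a' - (1 / 2 : ℂ) • (b' + e')) := by
      intros; module
    simp only [lindbladRHS, mul_add, add_mul, h, Finset.sum_add_distrib]
    module
  map_smul' c ρ := by
    have h : ∀ (r : ℂ) (a b e : Matrix (X × A) (X × A) ℂ),
        r • (c • a - (1 / 2 : ℂ) • (c • b + c • e)) = c • (r • (a - (1 / 2 : ℂ) • (b + e))) := by
      intros; module
    simp only [lindbladRHS, Matrix.mul_smul, Matrix.smul_mul, h, ← Finset.smul_sum,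
      RingHom.id_apply]
    module

/-- The psychological state `ρ_t = exp(t 𝓛) ρ_0`, that is, the solution of `dρ/dt = 𝓛 ρ` started
from `ρ_0` (the exponential is taken in the standard matrix coordinates of operators). -/
noncomputable def psychState (M : QuantumAgent X A) (η : X → ℝ) (t : ℝ) :
    Matrix (X × A) (X × A) ℂ :=
  Matrix.toLin (Matrix.stdBasis ℂ (X × A) (X × A)) (Matrix.stdBasis ℂ (X × A) (X × A))
    (NormedSpace.exp (t • LinearMap.toMatrix (Matrix.stdBasis ℂ (X × A) (X × A))
      (Matrix.stdBasis ℂ (X × A) (X × A)) (M.lindbladian η))) M.rho0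

open scoped Matrix.Norms.Operator in
/-- `psychState` solves the Lindblad equation, entry by entry. -/
theorem hasDerivAt_psychState (M : QuantumAgent X A) (η : X → ℝ) (t : ℝ) (i j : X × A) :
    HasDerivAt (fun s => M.psychState η s i j) (M.lindbladRHS η (M.psychState η t) i j) t := by
  set b := Matrix.stdBasis ℂ (X × A) (X × A) with hb
  set L := LinearMap.toMatrix b b (M.lindbladian η) with hL
  have h := hasDerivAt_exp_smul_const' (𝕂 := ℝ) L t
  have hF : ∀ N : Matrix ((X × A) × (X × A)) ((X × A) × (X × A)) ℂ,
      Matrix.toLin b b N M.rho0 i j = ∑ k, ∑ l, N k l * b.repr M.rho0 l * b k i j := by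
    intro N
    rw [Matrix.toLin_apply]
    simp [Matrix.sum_apply, Matrix.mulVec, dotProduct, Finset.sum_mul]
  have he : ∀ k l, HasDerivAt (fun s : ℝ => NormedSpace.exp (s • L) k l)
      ((L * NormedSpace.exp (t • L)) k l) t := by
    intro k l
    let ev : Matrix ((X × A) × (X × A)) ((X × A) × (X × A)) ℂ →ₗ[ℝ] ℂ :=
      { toFun := fun N => N k l, map_add' := fun _ _ => rfl, map_smul' := fun _ _ => rfl }
    exact (LinearMap.toContinuousLinearMap ev).hasFDerivAt.comp_hasDerivAt t h
  have e2 : M.lindbladRHS η (M.psychState η t)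
      = Matrix.toLin b b (L * NormedSpace.exp (t • L)) M.rho0 := by
    rw [Matrix.toLin_mul b b b, LinearMap.comp_apply, hL, Matrix.toLin_toMatrix]
    rfl
  rw [e2, hF]
  have e3 : (fun s => M.psychState η s i j) = fun s : ℝ =>
      ∑ k, ∑ l, NormedSpace.exp (s • L) k l * b.repr M.rho0 l * b k i j := by
    funext s; exact hF _
  rw [e3]
  refine HasDerivAt.fun_sum fun k _ => HasDerivAt.fun_sum fun l _ => ?_
  exact ((he k l).mul_const _).mul_const _

theorem psychState_zero (M : QuantumAgent X A) (η : X → ℝ) : M.psychState η 0 = M.rho0 := by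
  simp [psychState]
/-- The projector `I ⊗ |a⟩⟨a|`. -/
def actionProj (a : A) : Matrix (X × A) (X × A) ℂ :=
  Matrix.diagonal fun i => if i.2 = a then 1 else 0

/-- `Γ^η(a, t) = Tr(P_a ρ_t P_a†)`. -/
noncomputable def actionProbAt (M : QuantumAgent X A) (η : X → ℝ) (a : A) (t : ℝ) : ℝ :=
  (actionProj a * M.psychState η t * (actionProj a)ᴴ).trace.re

/-- The steady-state action distribution `Γ^η(a) = lim_{t → ∞} Γ^η(a, t)`. -/
noncomputable def steadyAction (M : QuantumAgent X A) (η : X → ℝ) (a : A) : ℝ :=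
  limUnder atTop (M.actionProbAt η a)

end QuantumAgent

/-! ### The quickest change detection protocol

The state of nature takes values in `Fin 2`: the value `0` is the state after the change
(state `1` of the change detection literature, absorbing), the value `1` is the state before the
change (state `2`). A belief is a vector `π : Fin 2 → ℝ` in the standard simplex. -/

/-- The data of the protocol: the quantum decision maker (the same at each time), the persistence
probability `p`, the observation densities `B x y` with respect to the reference measure `ν`, and
the delay and false alarm penalties `d` and `f`. -/
structure QCDProtocol (A Y : Type*) [Fintype A] [MeasurableSpace Y] where
  agent : QuantumAgent (Fin 2) A
  p : ℝ
  p_nonneg : 0 ≤ p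
  p_lt_one : p < 1
  ν : Measure Y
  B : Fin 2 → Y → ℝ
  B_measurable : ∀ x, Measurable (B x)
  B_nonneg : ∀ x y, 0 ≤ B x y
  B_lintegral : ∀ x, ∫⁻ y, ENNReal.ofReal (B x y) ∂ν = 1
  d : ℝ
  d_pos : 0 < d
  f : ℝ
  f_nonneg : 0 ≤ f

/-- The two decisions of the quickest detector. -/
inductive Decision
  | announce
  | proceed

/-- The first `n` with `q n` (`⊤` if there is none). -/
noncomputable def firstTime (q : ℕ → Prop) : ℕ∞ := ⨅ (n : ℕ) (_ : q n), (n : ℕ∞)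

/-- The list of the first `n` entries of a sequence of actions, the latest first. -/
def actionHistory {A : Type*} (b : ℕ → A) : ℕ → List A
  | 0 => []
  | n + 1 => b n :: actionHistory b n

namespace QCDProtocol

variable {A Y : Type*} [Fintype A] [DecidableEq A] [MeasurableSpace Y]

/-- The transition matrix of the state of nature. -/
def trans (S : QCDProtocol A Y) : Matrix (Fin 2) (Fin 2) ℝ := !![1, 0; 1 - S.p, S.p]

/-- The predicted belief `P' π`. -/
def predict (S : QCDProtocol A Y) (π : Fin 2 → ℝ) : Fin 2 → ℝ := S.transᵀ *ᵥ π

/-- `σ(π, y) = 1' B_y P' π`. -/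
def obsNorm (S : QCDProtocol A Y) (π : Fin 2 → ℝ) (y : Y) : ℝ := ∑ x, S.B x y * S.predict π x

/-- The private belief `T(π, y) = B_y P' π / σ(π, y)`. -/
noncomputable def privateBelief (S : QCDProtocol A Y) (π : Fin 2 → ℝ) (y : Y) : Fin 2 → ℝ :=
  fun x => S.B x y * S.predict π x / S.obsNorm π y

/-- `Γ_y^π(a)`: the steady-state action distribution given the public belief `π` and the
observation `y`. -/
noncomputable def humanAction (S : QCDProtocol A Y) (π : Fin 2 → ℝ) (y : Y) (a : A) : ℝ :=
  S.agent.steadyAction (S.privateBelief π y) a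

/-- `R_{x,π}(a) = ∫ Γ_y^π(a) B_{x,y} dy`. -/
noncomputable def actionLik (S : QCDProtocol A Y) (x : Fin 2) (π : Fin 2 → ℝ) (a : A) : ℝ :=
  ∫ y, S.humanAction π y a * S.B x y ∂S.ν

/-- `σ̄(π, a) = 1' R_π(a) P' π`. -/
noncomputable def actionNorm (S : QCDProtocol A Y) (π : Fin 2 → ℝ) (a : A) : ℝ :=
  ∑ x, S.actionLik x π a * S.predict π x

/-- The public belief update `T̄(π, a) = R_π(a) P' π / σ̄(π, a)`. -/
noncomputable def update (S : QCDProtocol A Y) (π : Fin 2 → ℝ) (a : A) : Fin 2 → ℝ :=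
  fun x => S.actionLik x π a * S.predict π x / S.actionNorm π a

/-- The public belief after a history of actions (latest first), started from `π`. -/
noncomputable def publicBelief (S : QCDProtocol A Y) (π : Fin 2 → ℝ) : List A → (Fin 2 → ℝ)
  | [] => π
  | a :: h => S.update (S.publicBelief π h) a

/-- Under `P`, the processes `x` (state of nature), `y` (observations) and `a` (human actions) run
according to the protocol with initial public belief `π`. Here `y n` and `a n` are the observation
and the action of the `(n+1)`-st human, so that they go with `x (n + 1)`. The law is given by its
finite-dimensional distributions: given the past up to time `n` with public belief `π_n`, the
state moves by the transition matrix, the observation has density `B` given the new state, and the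
action has the steady-state distribution of the decision maker fed with the private belief
`T(π_n, y)`. -/
structure IsRealization {Ω : Type*} [MeasurableSpace Ω] (S : QCDProtocol A Y) (π : Fin 2 → ℝ)
    (P : Measure Ω) (x : ℕ → Ω → Fin 2) (y : ℕ → Ω → Y) (a : ℕ → Ω → A) : Prop where
  measurableSet_state : ∀ n i, MeasurableSet {ω | x n ω = i}
  measurable_obs : ∀ n, Measurable (y n)
  measurableSet_action : ∀ n b, MeasurableSet {ω | a n ω = b}
  law_zero : ∀ i, P {ω | x 0 ω = i} = ENNReal.ofReal (π i)
  law_succ : ∀ (i : ℕ → Fin 2) (E : ℕ → Set Y) (b : ℕ → A), (∀ k, MeasurableSet (E k)) → ∀ n,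
    P {ω | (∀ k ≤ n + 1, x k ω = i k) ∧ ∀ k < n + 1, y k ω ∈ E k ∧ a k ω = b k}
      = P {ω | (∀ k ≤ n, x k ω = i k) ∧ ∀ k < n, y k ω ∈ E k ∧ a k ω = b k}
        * ENNReal.ofReal (S.trans (i n) (i (n + 1)))
        * ∫⁻ v in E n,
            ENNReal.ofReal
              (S.humanAction (S.publicBelief π (actionHistory b n)) v (b n))
              * ENNReal.ofReal (S.B (i (n + 1)) v) ∂S.ν

/-- The time `inf {n : u_n = announce}` of the announcement when `u_n` is the function `u` of the
actions `a_1, …, a_n` seen so far. -/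
noncomputable def announceTime {Ω : Type*} (a : ℕ → Ω → A) (u : List A → Decision) (ω : Ω) : ℕ∞ :=
  firstTime fun n => u (actionHistory (fun k => a k ω) n) = Decision.announce

/-- The change time `inf {n : x_n = 1}`. -/
noncomputable def changeTime {Ω : Type*} (x : ℕ → Ω → Fin 2) (ω : Ω) : ℕ∞ :=
  firstTime fun n => x n ω = 0

/-- The Kolmogorov–Shiryaev cost `d E[(τ - τ⁰)⁺] + f P(τ < τ⁰)` of a policy `u`
(subtraction in `ℕ∞` is truncated at `0`). -/
noncomputable def cost {Ω : Type*} [MeasurableSpace Ω] (S : QCDProtocol A Y) (P : Measure Ω)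
    (x : ℕ → Ω → Fin 2) (a : ℕ → Ω → A) (u : List A → Decision) : ℝ≥0∞ :=
  ENNReal.ofReal S.d * ∫⁻ ω, ((announceTime a u ω - changeTime x ω : ℕ∞) : ℝ≥0∞) ∂P
    + ENNReal.ofReal S.f * P {ω | announceTime a u ω < changeTime x ω}

/-- The policy `u_n = μ(π_n)` given by a stationary policy `μ` when the initial belief is `π`. -/
noncomputable def stationary (S : QCDProtocol A Y) (μ : (Fin 2 → ℝ) → Decision) (π : Fin 2 → ℝ) :
    List A → Decision :=
  fun h => μ (S.publicBelief π h)

variable {Ω : Type*} [MeasurableSpace Ω]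

/-- The optimal cost `inf_u J_u(π)` over all policies based on the history of actions, where
`P π` is the law of the protocol with initial belief `π`. -/
noncomputable def value (S : QCDProtocol A Y) (P : (Fin 2 → ℝ) → Measure Ω)
    (x : ℕ → Ω → Fin 2) (a : ℕ → Ω → A) (π : Fin 2 → ℝ) : ℝ≥0∞ :=
  ⨅ u : List A → Decision, S.cost (P π) x a u

/-- The stationary policy `μ` attains `inf_u J_u(π)` for each initial belief `π`. -/
def IsOptimal (S : QCDProtocol A Y) (P : (Fin 2 → ℝ) → Measure Ω)
    (x : ℕ → Ω → Fin 2) (a : ℕ → Ω → A) (μ : (Fin 2 → ℝ) → Decision) : Prop :=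
  ∀ π ∈ stdSimplex ℝ (Fin 2), S.cost (P π) x a (S.stationary μ π) = S.value P x a π

/-- `Q(π, announce) = f π(2)`. -/
noncomputable def QAnnounce (S : QCDProtocol A Y) (π : Fin 2 → ℝ) : ℝ≥0∞ :=
  ENNReal.ofReal (S.f * π 1)

/-- `Q(π, proceed) = d π(1) + ∑_a V(T̄(π, a)) σ̄(π, a)`. -/
noncomputable def QProceed (S : QCDProtocol A Y) (P : (Fin 2 → ℝ) → Measure Ω)
    (x : ℕ → Ω → Fin 2) (a : ℕ → Ω → A) (π : Fin 2 → ℝ) : ℝ≥0∞ :=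
  ENNReal.ofReal (S.d * π 0)
    + ∑ b, S.value P x a (S.update π b) * ENNReal.ofReal (S.actionNorm π b)

open Classical in
/-- The optimal policy `μ*(π) = argmin {Q(π, announce), Q(π, proceed)}`, with stopping set
`{π : Q(π, announce) ≤ Q(π, proceed)}`. -/
noncomputable def optimalPolicy (S : QCDProtocol A Y) (P : (Fin 2 → ℝ) → Measure Ω)
    (x : ℕ → Ω → Fin 2) (a : ℕ → Ω → A) (π : Fin 2 → ℝ) : Decision :=
  if S.QAnnounce π ≤ S.QProceed P x a π then Decision.announce else Decision.proceed

end QCDProtocol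

set_option linter.unusedSectionVars false

/-! ### Stability of a damped linear system -/

/-! The single threshold rests on the steady-state action law being affine in the belief. Tracing
out the state of nature leaves an equation on the action space that is coupled to the rest only
through the populations of the states of nature. For a fixed action it closes on five real functions
obeying a linear system with constant coefficients, and a quadratic Lyapunov function proves
convergence. The cases `alpha = phi = 1` and a single action are treated separately. The limit is
`Γ^η(a) = ∑ x, η x * G x a` with a Markov kernel `G` (`exists_actionKernel`): the human acts as if a
state were sampled from the private belief and then an action from `G`.

Let `q = p π(1)` in the indexing of `Fin 2`, where `1` is the state before the change, and let `g₀`,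
`g₁` be the entries of `G` at an action. The action has probability `(1 - q) g₀ + q g₁`, and Bayes'
rule gives the pre-change state the unnormalised weight `q g₁ - h(q) (g₁ - g₀)`, where `h` is the
posterior overlap of the two observation densities. Three facts about `h` suffice: `h ≤ q (1 - q)`,
`h / q` is nonincreasing, and `h / (1 - q)` is nondecreasing. By them the posterior weight after a
given action is nondecreasing in `q`, and an action likelier before the change does not lower the
weight. So the expectation of a nondecreasing function of the posterior weight is nondecreasing in
`q` (`sum_mixLik_mul_postWeight_mono`). No concavity of the value function is used.

Dynamic programming is run on the gain over immediate announcement, as a function of the pre-change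
probability. Value iteration keeps it nondecreasing, and the delay cost makes the gain of proceeding
increase with slope at least `d` (`proceedGain_add_le`). Hence proceeding pays exactly above one
level (`exists_gain_threshold`), and the slope leaves a strict gap below that level, which
determines every optimal stationary policy off the threshold.

To reach the actual cost, the law of the protocol is summed over states and observations: the public
belief is the conditional law of the state given the actions, the cost is a sum over action
histories (`cost_eq`), and the Bellman equation holds. The `n`-step and the optimal cost differ by
at most `f p^n`, since the change has not occurred by time `n` with probability at most `p^n`. -/

theorem tendsto_zero_of_lyapunov {U U' z : ℝ → ℝ} {c K : ℝ} (hc : 0 < c)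
    (hU : ∀ t, HasDerivAt U (U' t) t) (hU' : ∀ t, U' t ≤ -c * U t) (hz : ∀ t, z t ^ 2 ≤ K * U t)
    (hK : 0 ≤ K) : Tendsto z atTop (𝓝 0) := by
  have hd : ∀ t, HasDerivAt (fun s => U s * Real.exp (c * s))
      (U' t * Real.exp (c * t) + U t * (Real.exp (c * t) * c)) t := by
    intro t
    have h1 : HasDerivAt (fun s => Real.exp (c * s)) (Real.exp (c * t) * c) t := by
      simpa using ((hasDerivAt_id t).const_mul c).exp
    exact (hU t).mul h1
  have hanti : Antitone fun s => U s * Real.exp (c * s) := by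
    apply antitone_of_hasDerivAt_nonpos hd
    intro t
    have := mul_le_mul_of_nonneg_right (hU' t) (Real.exp_pos (c * t)).le
    simp only [Pi.zero_apply]
    linarith
  have hbound : ∀ t, 0 ≤ t → z t ^ 2 ≤ K * U 0 * Real.exp (-(c * t)) := by
    intro t ht
    have h := hanti ht
    simp only [mul_zero, Real.exp_zero, mul_one] at h
    have h2 : U t ≤ U 0 * Real.exp (-(c * t)) := by
      rw [Real.exp_neg, ← div_eq_mul_inv, le_div_iff₀ (Real.exp_pos _)]
      exact h
    calc z t ^ 2 ≤ K * U t := hz t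
      _ ≤ K * (U 0 * Real.exp (-(c * t))) := mul_le_mul_of_nonneg_left h2 hK
      _ = _ := by ring
  have hlim : Tendsto (fun t : ℝ => K * U 0 * Real.exp (-(c * t))) atTop (𝓝 0) := by
    have h1 : Tendsto (fun t : ℝ => c * t) atTop atTop := tendsto_id.const_mul_atTop hc
    simpa using (Real.tendsto_exp_neg_atTop_nhds_zero.comp h1).const_mul (K * U 0)
  have hsq : Tendsto (fun t => z t ^ 2) atTop (𝓝 0) := by
    refine tendsto_of_tendsto_of_tendsto_of_le_of_le' tendsto_const_nhds hlim
      (Eventually.of_forall fun t => sq_nonneg _) ?_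
    filter_upwards [eventually_ge_atTop 0] with t ht using hbound t ht
  have h3 := hsq.sqrt
  simp only [Real.sqrt_sq_eq_abs, Real.sqrt_zero] at h3
  exact (tendsto_zero_iff_abs_tendsto_zero _).2 h3

/-- In `2 N z² + w² + C F² + Kq q² + Kv v²` the exchange terms `z w` and `w F` cancel in the
derivative, because `b = 2 N κ` and `C e = c`. The constants `Kq` and `Kv` are chosen so that the
decay of `q` and `v` absorbs their forcing of `w` and `z` after completing squares. -/
theorem tendsto_zero_of_damped {z w F q v : ℝ → ℝ} {κ a b c e α β N C : ℝ}
    (ha : 0 < a) (hα : 0 < α) (hβ : 0 < β) (hN : 0 < N) (hC : 0 ≤ C) (hCe : C * e = c)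
    (hb : b = 2 * N * κ)
    (hz : ∀ t, HasDerivAt z (κ * w t - a * (z t - v t)) t)
    (hw : ∀ t, HasDerivAt w (-b * z t - c * F t + 2 * κ * q t - α * w t) t)
    (hF : ∀ t, HasDerivAt F (e * w t - α * F t) t)
    (hq : ∀ t, HasDerivAt q (-α * q t) t)
    (hv : ∀ t, HasDerivAt v (-β * v t) t) : Tendsto z atTop (𝓝 0) := by
  set Kq := 4 * κ ^ 2 / α ^ 2
  set Kv := 2 * N * a / β
  have hKq : 0 ≤ Kq := by positivity
  have hKv : 0 ≤ Kv := by positivity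
  have hKq' : α * (α * Kq) = 4 * κ ^ 2 := by simp only [Kq]; field_simp
  have hKv' : β * Kv = 2 * N * a := by simp only [Kv]; field_simp
  set m := min a (min α β)
  have hm : 0 < m := by simp [m, ha, hα, hβ]
  have hma : m ≤ a := min_le_left _ _
  have hmα : m ≤ α := (min_le_right _ _).trans (min_le_left _ _)
  have hmβ : m ≤ β := (min_le_right _ _).trans (min_le_right _ _)
  refine tendsto_zero_of_lyapunov (K := 1 / (2 * N)) hm
    (U := fun t => 2 * N * z t ^ 2 + w t ^ 2 + C * F t ^ 2 + Kq * q t ^ 2 + Kv * v t ^ 2)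
    (fun t => (((((hz t).pow 2).const_mul (2 * N)).add ((hw t).pow 2)).add
      (((hF t).pow 2).const_mul C)).add (((hq t).pow 2).const_mul Kq) |>.add
      (((hv t).pow 2).const_mul Kv)) ?_ ?_ (by positivity)
  · intro t
    simp only [Nat.cast_ofNat, Nat.add_one_sub_one, pow_one]
    generalize z t = z, w t = w, F t = F, q t = q, v t = v
    subst hb hCe
    have h1 : 0 ≤ 2 * N * a * (z - v) ^ 2 := by positivity
    have h2 : 0 ≤ (α * w - 2 * κ * q) ^ 2 / α := by positivity
    have h2' : (α * w - 2 * κ * q) ^ 2 / α = α * w ^ 2 - 4 * κ * w * q + α * Kq * q ^ 2 := by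
      rw [div_eq_iff hα.ne']
      linear_combination -q ^ 2 * hKq'
    have h3 := mul_le_mul_of_nonneg_right hma (by positivity : 0 ≤ 2 * N * z ^ 2)
    have h4 := mul_le_mul_of_nonneg_right hmα (by positivity : 0 ≤ w ^ 2)
    have h5 := mul_le_mul_of_nonneg_right hmα (by positivity : 0 ≤ C * F ^ 2)
    have h6 := mul_le_mul_of_nonneg_right hmα (by positivity : 0 ≤ Kq * q ^ 2)
    have h7 := mul_le_mul_of_nonneg_right hmβ (by positivity : 0 ≤ Kv * v ^ 2)
    have h8 : 0 ≤ α * (C * F ^ 2) := by positivity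
    have h9 : β * (Kv * v ^ 2) = 2 * N * a * v ^ 2 := by rw [← mul_assoc, hKv']
    nlinarith
  · intro t
    have h2 : 0 ≤ w t ^ 2 + C * F t ^ 2 + Kq * q t ^ 2 + Kv * v t ^ 2 := by positivity
    have : 1 / (2 * N) * (2 * N * z t ^ 2 + w t ^ 2 + C * F t ^ 2 + Kq * q t ^ 2 + Kv * v t ^ 2)
        = z t ^ 2 + 1 / (2 * N) * (w t ^ 2 + C * F t ^ 2 + Kq * q t ^ 2 + Kv * v t ^ 2) := by
      field_simp
      ring
    rw [this]
    have : 0 ≤ 1 / (2 * N) * (w t ^ 2 + C * F t ^ 2 + Kq * q t ^ 2 + Kv * v t ^ 2) := by positivity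
    linarith

/-- With `Kq = 8 κ² / α² + 4 ε κ / (N α)`, the quadratic form
`2 N z² + w² + C F² + 2 ε z w + Kq q²` is a Lyapunov function for small `ε`. -/
theorem tendsto_zero_of_damped_oscillator {z w F q : ℝ → ℝ} {κ b c e α N C : ℝ}
    (hκ : 0 < κ) (hα : 0 < α) (hN : 0 < N) (hC : 0 ≤ C) (hCe : C * e = c)
    (hb : b = 2 * N * κ)
    (hz : ∀ t, HasDerivAt z (κ * w t) t)
    (hw : ∀ t, HasDerivAt w (-b * z t - c * F t + 2 * κ * q t - α * w t) t)
    (hF : ∀ t, HasDerivAt F (e * w t - α * F t) t)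
    (hq : ∀ t, HasDerivAt q (-α * q t) t) : Tendsto z atTop (𝓝 0) := by
  -- Here `z` has no damping of its own; only the cross term `2 ε z w` dissipates it. The three
  -- smallness conditions keep the `w²` and `F²` errors it creates below their damping, and keep the
  -- form positive definite.
  obtain ⟨ε, hε, h1, h2, h3⟩ : ∃ ε > 0, ε * (2 * κ + α ^ 2 / (κ * N)) ≤ α / 2 ∧
      ε * (C * e ^ 2 / (κ * N)) ≤ α ∧ ε ^ 2 / N ≤ 1 / 2 := by
    have t1 : Tendsto (fun ε : ℝ => ε * (2 * κ + α ^ 2 / (κ * N))) (𝓝[>] 0) (𝓝 0) := by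
      refine (Continuous.tendsto' (by fun_prop) _ _ (by simp)).mono_left nhdsWithin_le_nhds
    have t2 : Tendsto (fun ε : ℝ => ε * (C * e ^ 2 / (κ * N))) (𝓝[>] 0) (𝓝 0) := by
      refine (Continuous.tendsto' (by fun_prop) _ _ (by simp)).mono_left nhdsWithin_le_nhds
    have t3 : Tendsto (fun ε : ℝ => ε ^ 2 / N) (𝓝[>] 0) (𝓝 0) := by
      refine (Continuous.tendsto' (by fun_prop) _ _ (by simp)).mono_left nhdsWithin_le_nhds
    obtain ⟨ε, h1, h2, h3, h4⟩ := ((t1.eventually_le_const (half_pos hα)).and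
      ((t2.eventually_le_const hα).and ((t3.eventually_le_const (by norm_num :
        (0 : ℝ) < 1 / 2)).and self_mem_nhdsWithin))).exists
    exact ⟨ε, h4, h1, h2, h3⟩
  set Kq := 8 * κ ^ 2 / α ^ 2 + 4 * ε * κ / (N * α) with hKqdef
  have hKq : 0 ≤ Kq := by positivity
  -- The cross term yields `4 ε κ N z²` of dissipation, and the squares `g1`, `g2`, `g3` below use
  -- one quarter each. The form is bounded by `3 N z² + (3/2) w²` plus the `F` and `q` terms, hence
  -- the rate `ε κ / 3`.
  set m := min (ε * κ / 3) (α / 2)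
  have hm : 0 < m := by simp only [m]; positivity
  have hm1 : m ≤ ε * κ / 3 := min_le_left _ _
  have hm2 : m ≤ α / 2 := min_le_right _ _
  have hlow : ∀ x y : ℝ, -(N * x ^ 2 + y ^ 2 / 2) ≤ 2 * ε * x * y ∧
      2 * ε * x * y ≤ N * x ^ 2 + y ^ 2 / 2 := by
    intro x y
    have e1 : 0 ≤ (N * x + ε * y) ^ 2 / N := by positivity
    have e2 : 0 ≤ (N * x - ε * y) ^ 2 / N := by positivity
    have e3 : (N * x + ε * y) ^ 2 / N = N * x ^ 2 + 2 * ε * x * y + ε ^ 2 / N * y ^ 2 := by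
      field_simp; ring
    have e4 : (N * x - ε * y) ^ 2 / N = N * x ^ 2 - 2 * ε * x * y + ε ^ 2 / N * y ^ 2 := by
      field_simp; ring
    have e5 := mul_le_mul_of_nonneg_right h3 (sq_nonneg y)
    constructor <;> linarith
  refine tendsto_zero_of_lyapunov (K := 1 / N) hm
    (U := fun t => 2 * N * z t ^ 2 + w t ^ 2 + C * F t ^ 2 + 2 * ε * (z t * w t) + Kq * q t ^ 2)
    (fun t => (((((hz t).pow 2).const_mul (2 * N)).add ((hw t).pow 2)).add
      (((hF t).pow 2).const_mul C)).add (((hz t).mul (hw t)).const_mul (2 * ε)) |>.add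
      (((hq t).pow 2).const_mul Kq)) ?_ ?_ (by positivity)
  · intro t
    simp only [Nat.cast_ofNat, Nat.add_one_sub_one, pow_one]
    have hl := (hlow (z t) (w t)).2
    generalize z t = z, w t = w, F t = F, q t = q at *
    subst hb hCe
    have g1 : 0 ≤ ε * (κ * N * z + C * e * F) ^ 2 / (κ * N) := by positivity
    have g1' : ε * (κ * N * z + C * e * F) ^ 2 / (κ * N)
        = ε * κ * N * z ^ 2 + 2 * ε * C * e * F * z + (ε * (C * e ^ 2 / (κ * N))) * (C * F ^ 2) := by
      field_simp; ring
    have g2 : 0 ≤ ε * (κ * N * z + α * w) ^ 2 / (κ * N) := by positivity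
    have g2' : ε * (κ * N * z + α * w) ^ 2 / (κ * N)
        = ε * κ * N * z ^ 2 + 2 * ε * α * z * w + ε * (α ^ 2 / (κ * N)) * w ^ 2 := by
      field_simp; ring
    have g3 : 0 ≤ ε * κ * (N * z - 2 * q) ^ 2 / N := by positivity
    have g3' : ε * κ * (N * z - 2 * q) ^ 2 / N
        = ε * κ * N * z ^ 2 - 4 * ε * κ * q * z + 4 * ε * κ / N * q ^ 2 := by
      field_simp; ring
    have g4 : 0 ≤ (α * w - 4 * κ * q) ^ 2 / (2 * α) := by positivity
    have g4' : (α * w - 4 * κ * q) ^ 2 / (2 * α)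
        = α / 2 * w ^ 2 - 4 * κ * w * q + 8 * κ ^ 2 / α * q ^ 2 := by
      field_simp; ring
    have g5 := mul_le_mul_of_nonneg_right h1 (sq_nonneg w)
    have g6 := mul_le_mul_of_nonneg_right h2 (by positivity : 0 ≤ C * F ^ 2)
    have g7 : α * Kq = 8 * κ ^ 2 / α + 4 * ε * κ / N := by
      rw [hKqdef]; field_simp
    have g8 : α * Kq * q ^ 2 = 8 * κ ^ 2 / α * q ^ 2 + 4 * ε * κ / N * q ^ 2 := by
      rw [g7]; ring
    have k1 := mul_le_mul_of_nonneg_right hm1 (by positivity : 0 ≤ 3 * N * z ^ 2)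
    have k2 := mul_le_mul_of_nonneg_right hm2 (by positivity : 0 ≤ 3 / 2 * w ^ 2)
    have k3 := mul_le_mul_of_nonneg_right hm2 (by positivity : 0 ≤ C * F ^ 2)
    have k4 := mul_le_mul_of_nonneg_right hm2 (by positivity : 0 ≤ Kq * q ^ 2)
    have k5 := mul_le_mul_of_nonneg_left hl hm.le
    have k6 : 0 ≤ α * (C * F ^ 2) := by positivity
    have k7 : 0 ≤ α * (Kq * q ^ 2) := by positivity
    have k8 : 0 ≤ α * w ^ 2 := by positivity
    linarith
  · intro t
    have hl := (hlow (z t) (w t)).1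
    have h2 : 0 ≤ C * F t ^ 2 + Kq * q t ^ 2 := by positivity
    rw [one_div, inv_mul_eq_div, le_div_iff₀ hN]
    nlinarith [sq_nonneg (w t)]

theorem tendsto_zero_of_damped_of_pos {z w F q v : ℝ → ℝ} {κ a b c e α β N C : ℝ}
    (ha : 0 ≤ a) (hnd : 0 < a ∨ 0 < κ)
    (hα : 0 < α) (hβ : 0 < β) (hN : 0 < N) (hC : 0 ≤ C) (hCe : C * e = c)
    (hb : b = 2 * N * κ)
    (hz : ∀ t, HasDerivAt z (κ * w t - a * (z t - v t)) t)
    (hw : ∀ t, HasDerivAt w (-b * z t - c * F t + 2 * κ * q t - α * w t) t)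
    (hF : ∀ t, HasDerivAt F (e * w t - α * F t) t)
    (hq : ∀ t, HasDerivAt q (-α * q t) t)
    (hv : ∀ t, HasDerivAt v (-β * v t) t) : Tendsto z atTop (𝓝 0) := by
  rcases ha.eq_or_lt with h0 | h0
  · have hκ' : 0 < κ := hnd.resolve_left (by simp [← h0])
    exact tendsto_zero_of_damped_oscillator hκ' hα hN hC hCe hb
      (fun t => by simpa [← h0] using hz t) hw hF hq
  · exact tendsto_zero_of_damped h0 hα hβ hN hC hCe hb hz hw hF hq hv

/-- Convergence of the populations `z` coupled to the coherences `w`, `F`. -/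
theorem tendsto_population {z w F q v : ℝ → ℝ} {κ α ψ β N v₀ : ℝ}
    (hψ : 0 ≤ ψ) (hnd : 0 < ψ ∨ 0 < κ) (hα : 0 < α) (hβ : 0 < β) (hN : 2 ≤ N)
    (hz : ∀ t, HasDerivAt z (κ * w t + α * ψ * (v t - z t)) t)
    (hw : ∀ t, HasDerivAt w (-κ * (N * (F t + 2 * z t) - 2 * q t) - α * w t) t)
    (hF : ∀ t, HasDerivAt F (κ * (N - 2) * w t - α * F t) t)
    (hq : ∀ t, HasDerivAt q (α * (1 - q t)) t)
    (hv : ∀ t, HasDerivAt v (β * (v₀ - v t)) t) :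
    Tendsto z atTop (𝓝 ((2 * κ ^ 2 + (α ^ 2 + κ ^ 2 * N * (N - 2)) * ψ * v₀) /
      ((α ^ 2 + κ ^ 2 * N * (N - 2)) * ψ + N * (2 * κ ^ 2)))) := by
  set Δ := α ^ 2 + κ ^ 2 * N * (N - 2) with hΔ
  have hN2 : 0 ≤ N - 2 := by linarith
  have hN0 : 0 < N := by linarith
  have hΔ0 : 0 < Δ := by positivity
  have hden : 0 < Δ * ψ + N * (2 * κ ^ 2) := by
    rcases hnd with h | h
    · have : 0 ≤ N * (2 * κ ^ 2) := by positivity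
      have : 0 < Δ * ψ := by positivity
      linarith
    · have : 0 < N * (2 * κ ^ 2) := by positivity
      have : 0 ≤ Δ * ψ := by positivity
      linarith
  -- The stationary point at `q = 1`, `v = v₀`, found by eliminating `F₀` and then `w₀`.
  set z₀ := (2 * κ ^ 2 + Δ * ψ * v₀) / (Δ * ψ + N * (2 * κ ^ 2)) with hz₀
  have hz₀' : z₀ * (Δ * ψ + N * (2 * κ ^ 2)) = 2 * κ ^ 2 + Δ * ψ * v₀ := by
    rw [hz₀]; exact div_mul_cancel₀ _ hden.ne'
  set w₀ := 2 * κ * (1 - N * z₀) * α / Δ with hw₀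
  have hw₀' : w₀ * Δ = 2 * κ * (1 - N * z₀) * α := by rw [hw₀]; field_simp
  set F₀ := κ * (N - 2) * w₀ / α with hF₀
  have hF₀' : F₀ * α = κ * (N - 2) * w₀ := by rw [hF₀]; field_simp
  have eq1 : κ * w₀ = α * ψ * (z₀ - v₀) := by
    have : (κ * w₀) * Δ = α * ψ * (z₀ - v₀) * Δ := by
      linear_combination κ * hw₀' - α * hz₀'
    exact mul_right_cancel₀ hΔ0.ne' this
  have eq2 : κ * (N * (F₀ + 2 * z₀) - 2) + α * w₀ = 0 := by
    have : (κ * (N * (F₀ + 2 * z₀) - 2) + α * w₀) * α = 0 := by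
      rw [hΔ] at hw₀'
      linear_combination κ * N * hF₀' + hw₀'
    exact (mul_eq_zero.1 this).resolve_right hα.ne'
  have key : Tendsto (fun t => z t - z₀) atTop (𝓝 0) := by
    have hz' : ∀ t, HasDerivAt (fun t => z t - z₀)
        (κ * (w t - w₀) - α * ψ * ((z t - z₀) - (v t - v₀))) t := fun t => by
      refine ((hz t).sub_const z₀).congr_deriv ?_
      linear_combination eq1
    have hv' : ∀ t, HasDerivAt (fun t => v t - v₀) (-β * (v t - v₀)) t := fun t =>
      ((hv t).sub_const v₀).congr_deriv (by ring)
    have hF' : ∀ t, HasDerivAt (fun t => F t - F₀)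
        (κ * (N - 2) * (w t - w₀) - α * (F t - F₀)) t := fun t =>
      ((hF t).sub_const F₀).congr_deriv (by linear_combination -hF₀')
    have hnd' : 0 < α * ψ ∨ 0 < κ := hnd.imp_left fun h => by positivity
    -- For `N = 2` the weight `C = N / (N - 2)` breaks down, but `F` then decays on its own. It
    -- enters the equation of `w` only as a forcing and is merged into `q`.
    rcases hN2.eq_or_lt with h2 | h2
    · have hNe : N = 2 := by linarith
      have hF0 : F₀ = 0 := by rw [hF₀, ← h2]; simp
      refine tendsto_zero_of_damped_of_pos (w := fun t => w t - w₀) (F := fun _ => 0)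
        (q := fun t => (q t - 1) - F t) (v := fun t => v t - v₀) (a := α * ψ) (c := 0) (e := 0)
        (C := 0) (N := N) (by positivity) hnd' hα hβ hN0 le_rfl (by simp) rfl hz' ?_ ?_ ?_ hv'
      · intro t
        refine ((hw t).sub_const w₀).congr_deriv ?_
        subst hNe
        rw [hF0] at eq2
        linear_combination -eq2
      · intro t; simpa using hasDerivAt_const t (0 : ℝ)
      · intro t
        refine (((hq t).sub_const 1).sub (hF t)).congr_deriv ?_
        rw [← h2]; ring
    · refine tendsto_zero_of_damped_of_pos (w := fun t => w t - w₀) (F := fun t => F t - F₀)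
        (q := fun t => q t - 1) (v := fun t => v t - v₀) (a := α * ψ) (c := κ * N)
        (e := κ * (N - 2)) (C := N / (N - 2)) (N := N) (by positivity) hnd' hα hβ hN0
        (by positivity) (by field_simp) rfl hz' ?_ hF' ?_ hv'
      · intro t
        refine ((hw t).sub_const w₀).congr_deriv ?_
        linear_combination -eq2
      · intro t
        exact ((hq t).sub_const 1).congr_deriv (by ring)
  simpa using key.add_const z₀

/-! ### The steady state of the Lindblad equation -/

namespace QuantumAgent

variable {X A : Type*} [Fintype X] [DecidableEq X] [Fintype A] [DecidableEq A]

theorem choiceProb_nonneg (M : QuantumAgent X A) (a : A) (x : X) : 0 ≤ M.choiceProb a x :=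
  div_nonneg (Real.rpow_nonneg (M.u_nonneg a x) _)
    (Finset.sum_nonneg fun b _ => Real.rpow_nonneg (M.u_nonneg b x) _)

theorem sum_choiceProb (M : QuantumAgent X A) (x : X) : ∑ a, M.choiceProb a x = 1 := by
  unfold choiceProb
  rw [← Finset.sum_div]
  obtain ⟨a, ha⟩ := M.exists_u_pos x
  have : 0 < ∑ b, M.u b x ^ M.lam :=
    Finset.sum_pos' (fun b _ => Real.rpow_nonneg (M.u_nonneg b x) _)
      ⟨a, Finset.mem_univ _, Real.rpow_pos_of_pos ha _⟩
  exact div_self this.ne'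

theorem sum_cognitiveMatrix (M : QuantumAgent X A) {η : X → ℝ} (hη : ∑ x, η x = 1) (n : X × A) :
    ∑ m, M.cognitiveMatrix η m n = 1 := by
  simp only [cognitiveMatrix, choiceMatrix, beliefMatrix, Matrix.add_apply, Matrix.smul_apply,
    Matrix.transpose_apply, Matrix.of_apply, smul_eq_mul, Finset.sum_add_distrib,
    ← Finset.mul_sum, Fintype.sum_prod_type]
  have h1 : ∑ x, ∑ a, (if n.1 = x then M.choiceProb a n.1 else 0) = 1 := by
    simp [Finset.sum_ite_irrel, sum_choiceProb]
  have h2 : ∑ x, ∑ a, (if n.2 = a then η x else 0) = 1 := by simp [hη]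
  rw [h1, h2]; ring

theorem sum_cognitiveMatrix_mul (M : QuantumAgent X A) (η : X → ℝ) (f : X × A → ℂ) (x : X) (a : A) :
    ∑ n, (M.cognitiveMatrix η (x, a) n : ℂ) * f n
      = (1 - M.phi) * (M.choiceProb a x * ∑ b, f (x, b)) + M.phi * (η x * ∑ k, f (k, a)) := by
  simp only [cognitiveMatrix, choiceMatrix, beliefMatrix, Matrix.add_apply, Matrix.smul_apply,
    Matrix.transpose_apply, Matrix.of_apply, smul_eq_mul, Complex.ofReal_add, Complex.ofReal_mul,
    add_mul, Finset.sum_add_distrib, mul_assoc, ← Finset.mul_sum, Fintype.sum_prod_type]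
  congr 1
  · simp [Finset.mul_sum]
    rw [Finset.sum_eq_single x] <;> simp +contextual
  · simp only [Finset.mul_sum]
    refine Finset.sum_congr rfl fun k _ => ?_
    rw [Finset.sum_eq_single a] <;> simp +contextual

theorem hamiltonian_mul_apply (ρ : Matrix (X × A) (X × A) ℂ) (x : X) (a : A) (j : X × A) :
    ((hamiltonian : Matrix (X × A) (X × A) ℂ) * ρ) (x, a) j = ∑ k, ρ (x, k) j := by
  rw [Matrix.mul_apply, Fintype.sum_prod_type, Finset.sum_eq_single x]
  · simp [hamiltonian]
  · intro y _ hy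
    simp [hamiltonian, hy.symm]
  · simp

theorem mul_hamiltonian_apply (ρ : Matrix (X × A) (X × A) ℂ) (x : X) (a : A) (i : X × A) :
    (ρ * (hamiltonian : Matrix (X × A) (X × A) ℂ)) i (x, a) = ∑ k, ρ i (x, k) := by
  rw [Matrix.mul_apply, Fintype.sum_prod_type, Finset.sum_eq_single x]
  · simp [hamiltonian]
  · intro y _ hy
    simp [hamiltonian, hy]
  · simp

theorem jump_mul_mul_jump (ρ : Matrix (X × A) (X × A) ℂ) (m n i j : X × A) :
    (jump m n * ρ * (jump m n)ᴴ) i j = if i = m ∧ j = m then ρ n n else 0 := by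
  simp only [jump, Matrix.conjTranspose_single, star_one]
  by_cases hi : i = m
  · by_cases hj : j = m
    · subst hi hj; simp
    · simp [hj]
  · simp [hi, Matrix.mul_assoc]

/-- The columns of the cognitive matrix sum to one, so the anticommutator terms collapse to `-ρ`;
the jumps feed only the diagonal. -/
theorem lindbladRHS_apply (M : QuantumAgent X A) {η : X → ℝ} (hη : ∑ x, η x = 1)
    (ρ : Matrix (X × A) (X × A) ℂ) (x y : X) (a b : A) :
    M.lindbladRHS η ρ (x, a) (y, b)
      = -(Complex.I * (1 - M.alpha)) * (∑ k, ρ (x, k) (y, b) - ∑ k, ρ (x, a) (y, k))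
        + M.alpha * ((if (x, a) = (y, b) then
            (1 - M.phi) * (M.choiceProb a x * ∑ b, ρ (x, b) (x, b))
              + M.phi * (η x * ∑ k, ρ (k, a) (k, a)) else 0) - ρ (x, a) (y, b)) := by
  have h1 : ∑ m, ∑ n, (M.cognitiveMatrix η m n : ℂ) *
      ((jump m n * ρ * (jump m n)ᴴ) (x, a) (y, b))
      = if (x, a) = (y, b) then (1 - M.phi) * (M.choiceProb a x * ∑ b, ρ (x, b) (x, b))
              + M.phi * (η x * ∑ k, ρ (k, a) (k, a)) else 0 := by
    simp only [jump_mul_mul_jump]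
    rw [Finset.sum_eq_single (x, a)]
    · by_cases h : (x, a) = (y, b)
      · rw [if_pos h]
        rw [← sum_cognitiveMatrix_mul M η (fun n => ρ n n)]
        simp [← h]
      · rw [if_neg h]
        refine Finset.sum_eq_zero fun n _ => ?_
        rw [if_neg, mul_zero]
        exact fun h' => h h'.2.symm
    · intro m _ hm
      refine Finset.sum_eq_zero fun n _ => ?_
      rw [if_neg, mul_zero]
      exact fun h' => hm h'.1.symm
    · simp
  have h2 : ∑ m, ∑ n, (M.cognitiveMatrix η m n : ℂ) *
      ((1 / 2 : ℂ) * (((jump m n)ᴴ * jump m n * ρ) (x, a) (y, b)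
        + (ρ * ((jump m n)ᴴ * jump m n)) (x, a) (y, b))) = ρ (x, a) (y, b) := by
    have hj : ∀ m n : X × A, (jump m n)ᴴ * jump m n = Matrix.single n n (1 : ℂ) := by
      intro m n; simp [jump, Matrix.conjTranspose_single]
    have hC : ∀ n, ∑ m, (M.cognitiveMatrix η m n : ℂ) = 1 := by
      intro n; exact_mod_cast M.sum_cognitiveMatrix hη n
    rw [Finset.sum_comm]
    simp only [hj, ← Finset.sum_mul, hC, one_mul, ← Finset.mul_sum, Finset.sum_add_distrib]
    rw [Finset.sum_eq_single (x, a), Finset.sum_eq_single (y, b)]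
    · simp; ring
    · intro n _ hn; simp [hn.symm]
    · simp
    · intro n _ hn; simp [hn.symm]
    · simp
  simp only [lindbladRHS, Matrix.add_apply, Matrix.smul_apply, Matrix.sub_apply, smul_eq_mul,
    Matrix.sum_apply, hamiltonian_mul_apply, mul_hamiltonian_apply, mul_sub,
    Finset.sum_sub_distrib, h1, h2]

end QuantumAgent

/-! ### Reduced dynamics on the action space -/

namespace QuantumAgent

variable {X A : Type*} [Fintype X] [DecidableEq X] [Fintype A] [DecidableEq A]

/-- The partial trace over the states of nature. -/
def reducedState (ρ : Matrix (X × A) (X × A) ℂ) (a b : A) : ℂ := ∑ x, ρ (x, a) (x, b)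

/-- The total population of a state of nature. -/
def population (ρ : Matrix (X × A) (X × A) ℂ) (x : X) : ℂ := ∑ a, ρ (x, a) (x, a)

theorem sum_population (ρ : Matrix (X × A) (X × A) ℂ) :
    ∑ x, population ρ x = ∑ a, reducedState ρ a a := Finset.sum_comm

theorem sum_population_eq_trace (ρ : Matrix (X × A) (X × A) ℂ) :
    ∑ x, population ρ x = ρ.trace := by
  simp [Matrix.trace, population, Fintype.sum_prod_type]

/-- The Hamiltonian is the identity on `X` tensored with an all-ones matrix on `A`, so its
commutator descends to the partial trace. The belief drops out of the `phi` term by `∑ x, η x = 1`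
and acts only through the populations. -/
theorem reducedState_lindbladRHS (M : QuantumAgent X A) {η : X → ℝ} (hη : ∑ x, η x = 1)
    (ρ : Matrix (X × A) (X × A) ℂ) (a b : A) :
    reducedState (M.lindbladRHS η ρ) a b
      = -(Complex.I * (1 - M.alpha)) * (∑ k, reducedState ρ k b - ∑ k, reducedState ρ a k)
        + M.alpha * ((if a = b then (1 - M.phi) * ∑ x, M.choiceProb a x * population ρ x
            + M.phi * reducedState ρ a a else 0) - reducedState ρ a b) := by
  have hη' : ∑ x, (η x : ℂ) = 1 := by exact_mod_cast hη
  simp only [reducedState, M.lindbladRHS_apply hη, Finset.sum_add_distrib, ← Finset.mul_sum,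
    Finset.sum_sub_distrib, Prod.mk.injEq, true_and, Finset.sum_ite_irrel, Finset.sum_const_zero,
    ← Finset.sum_mul, hη', one_mul, population]
  rw [Finset.sum_comm, Finset.sum_comm (f := fun x k => ρ (x, a) (x, k))]

/-- The Hamiltonian is block diagonal in the state of nature, so its commutator has zero trace on
each block and only the jumps move the populations. -/
theorem population_lindbladRHS (M : QuantumAgent X A) {η : X → ℝ} (hη : ∑ x, η x = 1)
    (ρ : Matrix (X × A) (X × A) ℂ) (x : X) :
    population (M.lindbladRHS η ρ) x
      = M.alpha * ((1 - M.phi) * population ρ x + M.phi * (η x * ∑ a, reducedState ρ a a)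
          - population ρ x) := by
  have hp : ∑ a, (M.choiceProb a x : ℂ) = 1 := by exact_mod_cast M.sum_choiceProb x
  simp only [reducedState, M.lindbladRHS_apply hη, Finset.sum_add_distrib, ← Finset.mul_sum,
    Finset.sum_sub_distrib, if_true, ← Finset.sum_mul, hp, one_mul, population]
  rw [Finset.sum_comm (f := fun a k => ρ (x, k) (x, a))]
  ring

theorem hasDerivAt_reducedState (M : QuantumAgent X A) {η : X → ℝ} (hη : ∑ x, η x = 1) (t : ℝ)
    (a b : A) :
    HasDerivAt (fun s => reducedState (M.psychState η s) a b)
      (-(Complex.I * (1 - M.alpha)) * (∑ k, reducedState (M.psychState η t) k b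
          - ∑ k, reducedState (M.psychState η t) a k)
        + M.alpha * ((if a = b then
            (1 - M.phi) * ∑ x, M.choiceProb a x * population (M.psychState η t) x
            + M.phi * reducedState (M.psychState η t) a a else 0)
            - reducedState (M.psychState η t) a b)) t := by
  rw [← M.reducedState_lindbladRHS hη]
  exact HasDerivAt.fun_sum fun x _ => M.hasDerivAt_psychState η t _ _

theorem sum_reducedState_psychState (M : QuantumAgent X A) {η : X → ℝ} (hη : ∑ x, η x = 1)
    (t : ℝ) : ∑ a, reducedState (M.psychState η t) a a = 1 := by
  have hη' : ∑ x, (η x : ℂ) = 1 := by exact_mod_cast hη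
  have hd : ∀ s, HasDerivAt (fun s => ∑ x, population (M.psychState η s) x) 0 s := by
    intro s
    have h : HasDerivAt (fun s => ∑ x, population (M.psychState η s) x)
        (∑ x, population (M.lindbladRHS η (M.psychState η s)) x) s :=
      HasDerivAt.fun_sum fun x _ => HasDerivAt.fun_sum fun a _ => M.hasDerivAt_psychState η s _ _
    refine h.congr_deriv ?_
    simp only [M.population_lindbladRHS hη, ← Finset.mul_sum, Finset.sum_sub_distrib,
      Finset.sum_add_distrib, ← Finset.sum_mul, hη', ← sum_population]
    ring
  have hc := is_const_of_deriv_eq_zero (fun s => (hd s).differentiableAt) (fun s => (hd s).deriv) t 0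
  rw [← sum_population]
  rw [hc, psychState_zero, sum_population_eq_trace, M.rho0_trace]

theorem hasDerivAt_population (M : QuantumAgent X A) {η : X → ℝ} (hη : ∑ x, η x = 1) (t : ℝ)
    (x : X) :
    HasDerivAt (fun s => population (M.psychState η s) x)
      (M.alpha * M.phi * (η x - population (M.psychState η t) x)) t := by
  have h : HasDerivAt (fun s => population (M.psychState η s) x)
      (population (M.lindbladRHS η (M.psychState η t)) x) t :=
    HasDerivAt.fun_sum fun a _ => M.hasDerivAt_psychState η t _ _
  refine h.congr_deriv ?_
  rw [M.population_lindbladRHS hη, M.sum_reducedState_psychState hη]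
  ring

theorem actionProbAt_eq (M : QuantumAgent X A) (η : X → ℝ) (a : A) (t : ℝ) :
    M.actionProbAt η a t = (reducedState (M.psychState η t) a a).re := by
  unfold actionProbAt actionProj reducedState
  rw [Matrix.diagonal_conjTranspose]
  congr 1
  simp only [Matrix.trace, Matrix.diag_apply, Matrix.mul_diagonal, Matrix.diagonal_mul,
    Fintype.sum_prod_type]
  refine Finset.sum_congr rfl fun x _ => ?_
  rw [Finset.sum_eq_single a]
  · simp
  · intro b _ hb; simp [hb]
  · simp

theorem hasDerivAt_re {f : ℝ → ℂ} {f' : ℂ} {t : ℝ} (h : HasDerivAt f f' t) :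
    HasDerivAt (fun s => (f s).re) f'.re t :=
  Complex.reCLM.hasFDerivAt.comp_hasDerivAt t h

theorem hasDerivAt_im {f : ℝ → ℂ} {f' : ℂ} {t : ℝ} (h : HasDerivAt f f' t) :
    HasDerivAt (fun s => (f s).im) f'.im t :=
  Complex.imCLM.hasFDerivAt.comp_hasDerivAt t h

/-- The choice probability averaged over the populations of the states of nature. -/
noncomputable def meanChoice (M : QuantumAgent X A) (η : X → ℝ) (a : A) (t : ℝ) : ℝ :=
  ∑ x, M.choiceProb a x * (population (M.psychState η t) x).re

theorem hasDerivAt_meanChoice (M : QuantumAgent X A) {η : X → ℝ} (hη : ∑ x, η x = 1) (t : ℝ)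
    (a : A) : HasDerivAt (M.meanChoice η a)
      (M.alpha * M.phi * (∑ x, M.choiceProb a x * η x - M.meanChoice η a t)) t := by
  have h : HasDerivAt (M.meanChoice η a) (∑ x, M.choiceProb a x *
      (M.alpha * M.phi * (η x - population (M.psychState η t) x) : ℂ).re) t :=
    HasDerivAt.fun_sum fun x _ => (hasDerivAt_re (M.hasDerivAt_population hη t x)).const_mul _
  refine h.congr_deriv ?_
  have e : ∀ x, (M.alpha * M.phi * (η x - population (M.psychState η t) x) : ℂ).re
      = M.alpha * M.phi * (η x - (population (M.psychState η t) x).re) := by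
    intro x
    rw [← Complex.ofReal_mul, Complex.re_ofReal_mul]; simp
  simp only [e, meanChoice, ← Finset.sum_sub_distrib, Finset.mul_sum]
  exact Finset.sum_congr rfl fun x _ => by ring

/-- The commutator sees the reduced state only through row and column sums, whose own equations
involve only the diagonal entry, themselves and the total sum. Real and imaginary parts are taken of
the equations directly, so it is never needed that `ρ_t` is Hermitian. -/
theorem tendsto_actionProbAt_of_two_le (M : QuantumAgent X A) {η : X → ℝ} (hη : ∑ x, η x = 1)
    (hA : 2 ≤ Fintype.card A) (hnd : M.phi < 1 ∨ M.alpha < 1) {β v₀ : ℝ} (hβ : 0 < β) (a : A)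
    (hv : ∀ t, HasDerivAt (M.meanChoice η a) (β * (v₀ - M.meanChoice η a t)) t) :
    Tendsto (M.actionProbAt η a) atTop (𝓝 ((2 * (1 - M.alpha) ^ 2 + (M.alpha ^ 2
      + (1 - M.alpha) ^ 2 * Fintype.card A * (Fintype.card A - 2)) * (1 - M.phi) * v₀) /
      ((M.alpha ^ 2 + (1 - M.alpha) ^ 2 * Fintype.card A * (Fintype.card A - 2)) * (1 - M.phi)
        + Fintype.card A * (2 * (1 - M.alpha) ^ 2)))) := by
  set R := fun t a b => reducedState (M.psychState η t) a b with hR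
  set v := fun t a => ∑ x, (M.choiceProb a x : ℂ) * population (M.psychState η t) x with hvdef
  set n : ℝ := (Fintype.card A : ℝ) with hn
  have hvre : ∀ t, (v t a).re = M.meanChoice η a t := by
    intro t
    simp [hvdef, meanChoice]
  have hvsum : ∀ t, ∑ a, v t a = 1 := by
    intro t
    simp only [hvdef]
    rw [Finset.sum_comm]
    simp only [← Finset.sum_mul]
    have h : ∀ x, ∑ a, (M.choiceProb a x : ℂ) = 1 := fun x => by exact_mod_cast M.sum_choiceProb x
    simp only [h, one_mul, sum_population, M.sum_reducedState_psychState hη]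
  have hRsum : ∀ t, ∑ a, R t a a = 1 := fun t => M.sum_reducedState_psychState hη t
  have hd : ∀ t a b, HasDerivAt (fun s => R s a b)
      (-(Complex.I * (1 - M.alpha)) * (∑ k, R t k b - ∑ k, R t a k)
        + M.alpha * ((if a = b then (1 - M.phi) * v t a + M.phi * R t a a else 0) - R t a b)) t :=
    fun t a b => M.hasDerivAt_reducedState hη t a b
  have hrow : ∀ t a, HasDerivAt (fun s => ∑ k, R s a k)
      (-(Complex.I * (1 - M.alpha)) * (∑ k, ∑ l, R t k l - n * ∑ k, R t a k)
        + M.alpha * ((1 - M.phi) * v t a + M.phi * R t a a - ∑ k, R t a k)) t := by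
    intro t a
    refine (HasDerivAt.fun_sum fun k _ => hd t a k).congr_deriv ?_
    simp only [Finset.sum_add_distrib, ← Finset.mul_sum, Finset.sum_sub_distrib,
      Finset.sum_ite_eq, Finset.mem_univ, if_true, Finset.sum_const, Finset.card_univ, nsmul_eq_mul]
    rw [Finset.sum_comm, hn]
    simp
  have hcol : ∀ t a, HasDerivAt (fun s => ∑ k, R s k a)
      (-(Complex.I * (1 - M.alpha)) * (n * ∑ k, R t k a - ∑ k, ∑ l, R t k l)
        + M.alpha * ((1 - M.phi) * v t a + M.phi * R t a a - ∑ k, R t k a)) t := by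
    intro t a
    refine (HasDerivAt.fun_sum fun k _ => hd t k a).congr_deriv ?_
    simp only [Finset.sum_add_distrib, ← Finset.mul_sum, Finset.sum_sub_distrib,
      Finset.sum_ite_eq', Finset.mem_univ, if_true, Finset.sum_const, Finset.card_univ,
      nsmul_eq_mul]
    rw [hn]
    simp
  have hQ : ∀ t, HasDerivAt (fun s => ∑ k, ∑ l, R s k l)
      (M.alpha * (1 - ∑ k, ∑ l, R t k l)) t := by
    intro t
    refine (HasDerivAt.fun_sum fun k _ => hrow t k).congr_deriv ?_
    simp only [Finset.sum_add_distrib, ← Finset.mul_sum, Finset.sum_sub_distrib, hvsum, hRsum,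
      Finset.sum_const, Finset.card_univ, nsmul_eq_mul]
    rw [hn]
    push_cast
    ring
  have h2 : (2 : ℝ) ≤ n := by rw [hn]; exact_mod_cast hA
  have hα0 : 0 ≤ 1 - M.alpha := sub_nonneg.2 M.alpha_le_one
  have hφ0 : 0 ≤ 1 - M.phi := sub_nonneg.2 M.phi_le_one
  have hfun : M.actionProbAt η a = fun t => (R t a a).re := funext fun t => M.actionProbAt_eq η a t
  rw [hfun]
  refine tendsto_population (z := fun t => (R t a a).re)
    (w := fun t => (∑ k, R t k a - ∑ k, R t a k).im)
    (F := fun t => (∑ k, R t k a + ∑ k, R t a k - 2 * R t a a).re)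
    (q := fun t => (∑ k, ∑ l, R t k l).re) (v := M.meanChoice η a) (κ := 1 - M.alpha)
    (α := M.alpha) (ψ := 1 - M.phi) (β := β) (N := n) hφ0
    (by rcases hnd with h | h <;> [left; right] <;> linarith) M.alpha_pos hβ h2 ?_ ?_ ?_ ?_ hv
  · intro t
    refine (hasDerivAt_re (hd t a a)).congr_deriv ?_
    simp [← hvre]
    ring
  · intro t
    refine (hasDerivAt_im ((hcol t a).sub (hrow t a))).congr_deriv ?_
    simp
    ring
  · intro t
    refine (hasDerivAt_re (((hcol t a).add (hrow t a)).sub ((hd t a a).const_mul 2))).congr_deriv ?_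
    simp
    ring
  · intro t
    refine (hasDerivAt_re (hQ t)).congr_deriv ?_
    simp
end QuantumAgent

/-! ### The steady-state action kernel -/

namespace QuantumAgent

variable {X A : Type*} [Fintype X] [DecidableEq X] [Fintype A] [DecidableEq A]

theorem population_rho0_nonneg (M : QuantumAgent X A) (x : X) : 0 ≤ (population M.rho0 x).re := by
  unfold population
  rw [Complex.re_sum]
  exact Finset.sum_nonneg fun a _ => (Complex.nonneg_iff.1 M.rho0_posSemidef.diag_nonneg).1

theorem reducedState_rho0_nonneg (M : QuantumAgent X A) (a : A) :
    0 ≤ (reducedState M.rho0 a a).re := by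
  unfold reducedState
  rw [Complex.re_sum]
  exact Finset.sum_nonneg fun x _ => (Complex.nonneg_iff.1 M.rho0_posSemidef.diag_nonneg).1

theorem sum_population_rho0 (M : QuantumAgent X A) : ∑ x, (population M.rho0 x).re = 1 := by
  rw [← Complex.re_sum, sum_population_eq_trace, M.rho0_trace, Complex.one_re]

theorem sum_reducedState_rho0 (M : QuantumAgent X A) : ∑ a, (reducedState M.rho0 a a).re = 1 := by
  rw [← Complex.re_sum, ← sum_population, sum_population_eq_trace, M.rho0_trace, Complex.one_re]

theorem nonempty_action (M : QuantumAgent X A) : Nonempty A := by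
  by_contra h
  rw [not_nonempty_iff] at h
  have := M.rho0_trace
  simp [Matrix.trace] at this

/-- Without Hamiltonian and choice terms the jumps conserve the diagonal of the reduced state, so
the initial action distribution persists. -/
theorem tendsto_actionProbAt_of_classical (M : QuantumAgent X A) {η : X → ℝ} (hη : ∑ x, η x = 1)
    (hφ : M.phi = 1) (hα : M.alpha = 1) (a : A) :
    Tendsto (M.actionProbAt η a) atTop (𝓝 (reducedState M.rho0 a a).re) := by
  have hd : ∀ s, HasDerivAt (fun s => reducedState (M.psychState η s) a a) 0 s := by
    intro s
    refine (M.hasDerivAt_reducedState hη s a a).congr_deriv ?_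
    simp [hφ, hα]
  have hc : ∀ t, M.actionProbAt η a t = (reducedState M.rho0 a a).re := by
    intro t
    rw [M.actionProbAt_eq, ← M.psychState_zero η]
    exact congrArg _ (is_const_of_deriv_eq_zero (fun s => (hd s).differentiableAt)
      (fun s => (hd s).deriv) t 0)
  exact tendsto_const_nhds.congr fun t => (hc t).symm

theorem tendsto_actionProbAt_of_subsingleton (M : QuantumAgent X A) {η : X → ℝ}
    (hη : ∑ x, η x = 1) [Subsingleton A] (a : A) :
    Tendsto (M.actionProbAt η a) atTop (𝓝 1) := by
  refine tendsto_const_nhds.congr fun t => ?_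
  rw [M.actionProbAt_eq]
  have h := M.sum_reducedState_psychState hη t
  rw [Fintype.sum_subsingleton _ a] at h
  rw [h, Complex.one_re]

/-- The steady-state action distribution depends affinely on the belief. -/
theorem exists_actionKernel (M : QuantumAgent X A) :
    ∃ G : X → A → ℝ, (∀ x a, 0 ≤ G x a) ∧ (∀ x, ∑ a, G x a = 1) ∧
      ∀ η ∈ stdSimplex ℝ X, ∀ a,
        Tendsto (M.actionProbAt η a) atTop (𝓝 (∑ x, η x * G x a)) := by
  obtain ⟨a₀⟩ := M.nonempty_action
  by_cases hcl : M.phi = 1 ∧ M.alpha = 1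
  · refine ⟨fun _ a => (reducedState M.rho0 a a).re, fun _ a => M.reducedState_rho0_nonneg a,
      fun _ => M.sum_reducedState_rho0, fun η h a => ?_⟩
    rw [← Finset.sum_mul, h.2, one_mul]
    exact M.tendsto_actionProbAt_of_classical h.2 hcl.1 hcl.2 a
  have hnd : M.phi < 1 ∨ M.alpha < 1 := by
    by_contra! h
    exact hcl ⟨le_antisymm M.phi_le_one h.1, le_antisymm M.alpha_le_one h.2⟩
  by_cases hs : Subsingleton A
  · refine ⟨fun _ _ => 1, fun _ _ => zero_le_one, fun _ => ?_, fun η h a => ?_⟩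
    · rw [Fintype.sum_subsingleton _ a₀]
    · rw [← Finset.sum_mul, h.2, one_mul]
      exact M.tendsto_actionProbAt_of_subsingleton h.2 a
  have hA : 2 ≤ Fintype.card A := by
    have := (Fintype.one_lt_card_iff_nontrivial (α := A)).2 (not_subsingleton_iff_nontrivial.1 hs)
    omega
  set n : ℝ := (Fintype.card A : ℝ) with hn
  have h2 : (2 : ℝ) ≤ n := by rw [hn]; exact_mod_cast hA
  have hκ : 0 ≤ 1 - M.alpha := sub_nonneg.2 M.alpha_le_one
  have hψ : 0 ≤ 1 - M.phi := sub_nonneg.2 M.phi_le_one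
  have hα := M.alpha_pos
  set Δ := M.alpha ^ 2 + (1 - M.alpha) ^ 2 * n * (n - 2) with hΔ
  have hΔ0 : 0 < Δ := by
    have : 0 ≤ (1 - M.alpha) ^ 2 * n * (n - 2) :=
      mul_nonneg (by positivity) (by linarith)
    positivity
  set den := Δ * (1 - M.phi) + n * (2 * (1 - M.alpha) ^ 2) with hden
  have hden0 : 0 < den := by
    have h1 : 0 ≤ n * (2 * (1 - M.alpha) ^ 2) := by positivity
    have h2' : 0 ≤ Δ * (1 - M.phi) := by positivity
    rcases hnd with h | h
    · have : 0 < 1 - M.phi := sub_pos.2 h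
      have : 0 < Δ * (1 - M.phi) := by positivity
      linarith
    · have : 0 < 1 - M.alpha := sub_pos.2 h
      have : 0 < n * (2 * (1 - M.alpha) ^ 2) := by positivity
      linarith
  -- The mean choice relaxes at rate `alpha * phi` to the average of `choiceProb` under `η`. For
  -- `phi = 0` it stays at its initial value, which then serves as its own target, and the rate `1`
  -- is arbitrary.
  obtain ⟨g, β, hβ, hg0, hg1, hgd⟩ : ∃ (g : X → A → ℝ) (β : ℝ), 0 < β ∧ (∀ x a, 0 ≤ g x a) ∧
      (∀ x, ∑ a, g x a = 1) ∧ ∀ η ∈ stdSimplex ℝ X, ∀ a t, HasDerivAt (M.meanChoice η a)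
        (β * (∑ x, η x * g x a - M.meanChoice η a t)) t := by
    by_cases hφ : M.phi = 0
    · have hd : ∀ η ∈ stdSimplex ℝ X, ∀ a t, HasDerivAt (M.meanChoice η a) 0 t := by
        intro η h a t
        refine (M.hasDerivAt_meanChoice h.2 t a).congr_deriv ?_
        simp [hφ]
      refine ⟨fun _ a => ∑ x, M.choiceProb a x * (population M.rho0 x).re, 1, one_pos,
        fun _ a => Finset.sum_nonneg fun x _ =>
          mul_nonneg (M.choiceProb_nonneg a x) (M.population_rho0_nonneg x), fun _ => ?_,
        fun η h a t => ?_⟩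
      · rw [Finset.sum_comm]
        simp only [← Finset.sum_mul, sum_choiceProb, one_mul, sum_population_rho0]
      · refine (hd η h a t).congr_deriv ?_
        rw [is_const_of_deriv_eq_zero (fun s => (hd η h a s).differentiableAt)
          (fun s => (hd η h a s).deriv) t 0, ← Finset.sum_mul, h.2, meanChoice, psychState_zero]
        ring
    · refine ⟨fun x a => M.choiceProb a x, M.alpha * M.phi,
        mul_pos hα (lt_of_le_of_ne M.phi_nonneg (Ne.symm hφ)), fun x a => M.choiceProb_nonneg a x,
        M.sum_choiceProb, fun η h a t => ?_⟩
      simpa only [mul_comm] using M.hasDerivAt_meanChoice h.2 t a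
  -- The limit is affine in the target `v₀ = ∑ x, η x * g x a`; since `η` sums to one, its constant
  -- term can be distributed over the states.
  refine ⟨fun x a => (2 * (1 - M.alpha) ^ 2 + Δ * (1 - M.phi) * g x a) / den, fun x a => ?_,
    fun x => ?_, fun η h a => ?_⟩
  · have := hg0 x a
    positivity
  · rw [← Finset.sum_div, Finset.sum_add_distrib, ← Finset.mul_sum _ _ (Δ * (1 - M.phi)), hg1,
      Finset.sum_const,
      Finset.card_univ, nsmul_eq_mul, div_eq_one_iff_eq hden0.ne', hden]
    ring
  · have := M.tendsto_actionProbAt_of_two_le h.2 hA hnd hβ a (hgd η h a)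
    convert this using 2
    rw [← hn, ← hΔ, ← hden, eq_div_iff hden0.ne', Finset.sum_mul]
    have e : ∀ x, η x * ((2 * (1 - M.alpha) ^ 2 + Δ * (1 - M.phi) * g x a) / den) * den
        = η x * (2 * (1 - M.alpha) ^ 2) + Δ * (1 - M.phi) * (η x * g x a) := by
      intro x; field_simp
    simp only [e, Finset.sum_add_distrib, ← Finset.sum_mul, ← Finset.mul_sum, h.2, one_mul]

/-- An action kernel of the steady state, extended to all beliefs. -/
theorem exists_steadyAction_eq (M : QuantumAgent X A) :
    ∃ G : X → A → ℝ, (∀ x a, 0 ≤ G x a) ∧ (∀ x, ∑ a, G x a = 1) ∧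
      ∀ η ∈ stdSimplex ℝ X, ∀ a, M.steadyAction η a = ∑ x, η x * G x a ∧
        Tendsto (M.actionProbAt η a) atTop (𝓝 (M.steadyAction η a)) := by
  obtain ⟨G, h0, h1, hG⟩ := M.exists_actionKernel
  refine ⟨G, h0, h1, fun η hη a => ?_⟩
  have h : M.steadyAction η a = ∑ x, η x * G x a := (hG η hη a).limUnder_eq
  exact ⟨h, h ▸ hG η hη a⟩

end QuantumAgent

/-! ### Monotonicity of the posterior sampling update -/

/-- The properties of the posterior overlap `h q` of two densities with prior weights
`1 - q` and `q` on which the monotonicity of the public update rests. -/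
structure IsOverlap (h : ℝ → ℝ) : Prop where
  nonneg : ∀ q ∈ Set.Icc (0 : ℝ) 1, 0 ≤ h q
  le_mul : ∀ q ∈ Set.Icc (0 : ℝ) 1, h q ≤ q * (1 - q)
  mul_le_mul : ∀ q ∈ Set.Icc (0 : ℝ) 1, ∀ q' ∈ Set.Icc (0 : ℝ) 1, q ≤ q' → h q' * q ≤ h q * q'
  mul_one_sub_le : ∀ q ∈ Set.Icc (0 : ℝ) 1, ∀ q' ∈ Set.Icc (0 : ℝ) 1, q ≤ q' →
    h q * (1 - q') ≤ h q' * (1 - q)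

namespace IsOverlap

variable {h : ℝ → ℝ}

theorem le_left (hh : IsOverlap h) {q : ℝ} (hq : q ∈ Set.Icc (0 : ℝ) 1) : h q ≤ q := by
  have := hh.le_mul q hq
  nlinarith [sq_nonneg q]

/-- As `h q / q` is nonincreasing and at most one, the increment of `h` is at most `(q' - q) * (h q
/ q) ≤ q' - q`. With the mirror bound below, `h` is 1-Lipschitz. -/
theorem sub_le_sub (hh : IsOverlap h) {q q' : ℝ} (hq : q ∈ Set.Icc (0 : ℝ) 1)
    (hq' : q' ∈ Set.Icc (0 : ℝ) 1) (hqq : q ≤ q') : h q' - h q ≤ q' - q := by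
  rcases hq.1.eq_or_lt with h0 | h0
  · subst h0
    have := hh.le_left hq'
    have := hh.nonneg 0 hq
    linarith
  · have h1 := hh.mul_le_mul q hq q' hq' hqq
    have h2 := hh.le_left hq
    have h3 : (h q' - h q) * q ≤ (q' - q) * q := by
      nlinarith
    exact le_of_mul_le_mul_right h3 h0

theorem sub_le_sub' (hh : IsOverlap h) {q q' : ℝ} (hq : q ∈ Set.Icc (0 : ℝ) 1)
    (hq' : q' ∈ Set.Icc (0 : ℝ) 1) (hqq : q ≤ q') : h q - h q' ≤ q' - q := by
  rcases hq.2.eq_or_lt with h0 | h0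
  · have h1 : q' = 1 := le_antisymm hq'.2 (h0 ▸ hqq)
    simp [h0, h1]
  · have h1 := hh.mul_one_sub_le q hq q' hq' hqq
    have h2 : h q ≤ 1 - q := by
      have := hh.le_mul q hq
      nlinarith [sq_nonneg (1 - q)]
    have h3 : (h q - h q') * (1 - q) ≤ (q' - q) * (1 - q) := by
      nlinarith
    exact le_of_mul_le_mul_right h3 (by linarith)

theorem continuousOn (hh : IsOverlap h) : ContinuousOn h (Set.Icc 0 1) := by
  have : LipschitzOnWith 1 h (Set.Icc 0 1) := by
    refine LipschitzOnWith.of_dist_le_mul fun q hq q' hq' => ?_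
    rw [Real.dist_eq, Real.dist_eq, NNReal.coe_one, one_mul]
    rcases le_total q q' with hqq | hqq
    · have h1 := hh.sub_le_sub hq hq' hqq
      have h2 := hh.sub_le_sub' hq hq' hqq
      rw [abs_sub_comm q, abs_of_nonneg (by linarith : 0 ≤ q' - q)]
      exact abs_le.2 ⟨by linarith, by linarith⟩
    · have h1 := hh.sub_le_sub hq' hq hqq
      have h2 := hh.sub_le_sub' hq' hq hqq
      rw [abs_of_nonneg (by linarith : 0 ≤ q - q')]
      exact abs_le.2 ⟨by linarith, by linarith⟩
  exact this.continuousOn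

end IsOverlap

/-- The probability of an action whose likelihoods in the two states are `g₀`, `g₁`. -/
def mixLik (g₀ g₁ q : ℝ) : ℝ := (1 - q) * g₀ + q * g₁

/-- The posterior weight of the second state after an action with likelihoods `g₀`, `g₁`. -/
noncomputable def postWeight (h : ℝ → ℝ) (g₀ g₁ q : ℝ) : ℝ :=
  (q * g₁ - h q * (g₁ - g₀)) / mixLik g₀ g₁ q

section Posterior

variable {h : ℝ → ℝ} {g₀ g₁ q q' : ℝ}

theorem mixLik_nonneg (h₀ : 0 ≤ g₀) (h₁ : 0 ≤ g₁) (hq : q ∈ Set.Icc (0 : ℝ) 1) :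
    0 ≤ mixLik g₀ g₁ q :=
  add_nonneg (mul_nonneg (by linarith [hq.2]) h₀) (mul_nonneg hq.1 h₁)

theorem IsOverlap.post_num_nonneg (hh : IsOverlap h) (h₀ : 0 ≤ g₀) (h₁ : 0 ≤ g₁)
    (hq : q ∈ Set.Icc (0 : ℝ) 1) : 0 ≤ q * g₁ - h q * (g₁ - g₀) := by
  have e1 := mul_nonneg (sub_nonneg.2 (hh.le_left hq)) h₁
  have e2 := mul_nonneg (hh.nonneg q hq) h₀
  linarith

theorem IsOverlap.post_num_le (hh : IsOverlap h) (h₀ : 0 ≤ g₀) (h₁ : 0 ≤ g₁)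
    (hq : q ∈ Set.Icc (0 : ℝ) 1) : q * g₁ - h q * (g₁ - g₀) ≤ mixLik g₀ g₁ q := by
  have e0 : h q ≤ 1 - q := by
    have := hh.le_mul q hq
    nlinarith [sq_nonneg (1 - q)]
  have e1 := mul_nonneg (sub_nonneg.2 e0) h₀
  have e2 := mul_nonneg (hh.nonneg q hq) h₁
  unfold mixLik
  linarith

/-- Valid also for an action of probability zero, where `postWeight` is the default `0`: the
numerator lies between `0` and `mixLik`. -/
theorem mixLik_mul_postWeight (hh : IsOverlap h) (h₀ : 0 ≤ g₀) (h₁ : 0 ≤ g₁)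
    (hq : q ∈ Set.Icc (0 : ℝ) 1) :
    mixLik g₀ g₁ q * postWeight h g₀ g₁ q = q * g₁ - h q * (g₁ - g₀) := by
  rcases (mixLik_nonneg h₀ h₁ hq).eq_or_lt with h0 | h0
  · have h1 := hh.post_num_nonneg h₀ h₁ hq
    have h2 := hh.post_num_le h₀ h₁ hq
    rw [← h0, zero_mul]
    linarith
  · rw [postWeight, mul_div_cancel₀ _ h0.ne']

theorem postWeight_mem_Icc (hh : IsOverlap h) (h₀ : 0 ≤ g₀) (h₁ : 0 ≤ g₁)
    (hq : q ∈ Set.Icc (0 : ℝ) 1) : postWeight h g₀ g₁ q ∈ Set.Icc (0 : ℝ) 1 :=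
  ⟨div_nonneg (hh.post_num_nonneg h₀ h₁ hq) (mixLik_nonneg h₀ h₁ hq),
    div_le_one_of_le₀ (hh.post_num_le h₀ h₁ hq) (mixLik_nonneg h₀ h₁ hq)⟩

/-- After cross-multiplication, with `m` the smaller likelihood and `D` the difference, the
inequality is a quadratic form in `m` and `D` with nonnegative coefficients; the properties of `h`
supply those of `m D` and `D²`. Positivity is required at `q'` because the default value `0` there
could break monotonicity. -/
theorem postWeight_mono (hh : IsOverlap h) (h₀ : 0 ≤ g₀) (h₁ : 0 ≤ g₁)
    (hq : q ∈ Set.Icc (0 : ℝ) 1) (hq' : q' ∈ Set.Icc (0 : ℝ) 1) (hqq : q ≤ q')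
    (hpos : 0 < mixLik g₀ g₁ q') : postWeight h g₀ g₁ q ≤ postWeight h g₀ g₁ q' := by
  rcases (mixLik_nonneg h₀ h₁ hq).eq_or_lt with h0 | h0
  · rw [postWeight, ← h0, div_zero]
    exact (postWeight_mem_Icc hh h₀ h₁ hq').1
  · unfold postWeight
    rw [div_le_div_iff₀ h0 hpos]
    unfold mixLik
    have a1 := hh.mul_le_mul q hq q' hq' hqq
    have a2 := hh.mul_one_sub_le q hq q' hq' hqq
    have a3 := hh.sub_le_sub hq hq' hqq
    have a4 := hh.sub_le_sub' hq hq' hqq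
    have b0 : 0 ≤ q' - q := by linarith
    rcases le_total g₀ g₁ with hg | hg
    · obtain ⟨D, rfl⟩ : ∃ D, g₁ = g₀ + D := ⟨g₁ - g₀, by ring⟩
      have hD : 0 ≤ D := by linarith
      have c1 : 0 ≤ (q' - q) * g₀ ^ 2 := by positivity
      have c2 : 0 ≤ (g₀ * D) * ((q' - q) + h q - h q') := mul_nonneg (by positivity) (by linarith)
      have c3 : 0 ≤ D ^ 2 * (h q * q' - h q' * q) := mul_nonneg (by positivity) (by linarith)
      linarith
    · obtain ⟨D, rfl⟩ : ∃ D, g₀ = g₁ + D := ⟨g₀ - g₁, by ring⟩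
      have hD : 0 ≤ D := by linarith
      have c1 : 0 ≤ (q' - q) * g₁ ^ 2 := by positivity
      have c2 : 0 ≤ (g₁ * D) * ((q' - q) + h q' - h q) := mul_nonneg (by positivity) (by linarith)
      have c3 : 0 ≤ D ^ 2 * (h q' * (1 - q) - h q * (1 - q')) :=
        mul_nonneg (by positivity) (by linarith)
      linarith

/-- The numerator minus `q` times the probability of the action equals `(g₁ - g₀) (q (1 - q) - h
q)`. -/
theorem postWeight_sub_sign (hh : IsOverlap h) (h₀ : 0 ≤ g₀) (h₁ : 0 ≤ g₁)
    (hq : q ∈ Set.Icc (0 : ℝ) 1) (hq1 : q < 1) :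
    (g₀ < g₁ → q ≤ postWeight h g₀ g₁ q) ∧ (g₁ < g₀ → postWeight h g₀ g₁ q ≤ q) := by
  have hle := hh.le_mul q hq
  constructor
  · intro hg
    rcases (mixLik_nonneg h₀ h₁ hq).eq_or_lt with h0 | h0
    · have : q * g₁ ≤ 0 := by
        rw [mixLik] at h0
        have : 0 ≤ (1 - q) * g₀ := mul_nonneg (by linarith) h₀
        linarith
      have : q ≤ 0 := by
        by_contra! hq0
        have : 0 < q * g₁ := mul_pos hq0 (by linarith)
        linarith
      exact this.trans (postWeight_mem_Icc hh h₀ h₁ hq).1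
    · rw [postWeight, le_div_iff₀ h0, mixLik]
      nlinarith
  · intro hg
    have h0 : 0 < mixLik g₀ g₁ q := by
      have e1 : 0 < (1 - q) * g₀ := mul_pos (by linarith) (by linarith)
      have e2 : 0 ≤ q * g₁ := mul_nonneg hq.1 h₁
      rw [mixLik]; linarith
    rw [postWeight, div_le_iff₀ h0, mixLik]
    nlinarith

/-- The posterior weight may jump where the action has probability zero, but there the factor
`mixLik` vanishes and `W` is bounded. -/
theorem continuousOn_mixLik_mul_postWeight (hh : IsOverlap h) (h₀ : 0 ≤ g₀) (h₁ : 0 ≤ g₁)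
    {W : ℝ → ℝ} {c : ℝ} (hW : ContinuousOn W (Set.Icc 0 1))
    (hWc : ∀ r ∈ Set.Icc (0 : ℝ) 1, |W r| ≤ c) :
    ContinuousOn (fun q => mixLik g₀ g₁ q * W (postWeight h g₀ g₁ q)) (Set.Icc 0 1) := by
  have hmix : Continuous (mixLik g₀ g₁) := by unfold mixLik; fun_prop
  intro q hq
  have hmaps : Set.MapsTo (postWeight h g₀ g₁) (Set.Icc 0 1) (Set.Icc 0 1) :=
    fun q hq => postWeight_mem_Icc hh h₀ h₁ hq
  by_cases h0 : mixLik g₀ g₁ q = 0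
  · unfold ContinuousWithinAt
    simp only [h0, zero_mul]
    have hlim : Tendsto (fun q => mixLik g₀ g₁ q * c) (𝓝[Set.Icc 0 1] q) (𝓝 0) := by
      have := (hmix.tendsto q).mul_const c
      rw [h0, zero_mul] at this
      exact this.mono_left nhdsWithin_le_nhds
    refine squeeze_zero_norm' ?_ hlim
    filter_upwards [self_mem_nhdsWithin] with q' hq'
    rw [Real.norm_eq_abs, abs_mul, abs_of_nonneg (mixLik_nonneg h₀ h₁ hq')]
    exact mul_le_mul_of_nonneg_left (hWc _ (hmaps hq')) (mixLik_nonneg h₀ h₁ hq')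
  · refine hmix.continuousWithinAt.mul ((hW _ (hmaps hq)).comp ?_ hmaps)
    have hhc := hh.continuousOn q hq
    exact ((continuousWithinAt_id.mul_const _).sub (hhc.mul_const _)).div
      hmix.continuousWithinAt h0

end Posterior

/-- Monotone functions of the posterior weight have expectations which are monotone in the
prior weight. -/
theorem sum_mixLik_mul_postWeight_mono {A : Type*} [Fintype A] {h : ℝ → ℝ} (hh : IsOverlap h)
    {G : Fin 2 → A → ℝ} (hG : ∀ x a, 0 ≤ G x a) (hG1 : ∀ x, ∑ a, G x a = 1) {W : ℝ → ℝ}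
    (hW : MonotoneOn W (Set.Icc 0 1)) {q q' : ℝ} (hq : q ∈ Set.Icc (0 : ℝ) 1)
    (hq' : q' ∈ Set.Icc (0 : ℝ) 1) (hqq : q ≤ q') (hq1 : q < 1) :
    ∑ a, mixLik (G 0 a) (G 1 a) q * W (postWeight h (G 0 a) (G 1 a) q)
      ≤ ∑ a, mixLik (G 0 a) (G 1 a) q' * W (postWeight h (G 0 a) (G 1 a) q') := by
  have hmem : ∀ a, postWeight h (G 0 a) (G 1 a) q ∈ Set.Icc (0 : ℝ) 1 :=
    fun a => postWeight_mem_Icc hh (hG 0 a) (hG 1 a) hq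
  -- The prior weight is moved in two stages: here inside the posterior, with action probabilities
  -- fixed at `q'`; in `h4` inside the action probabilities, with posteriors fixed at `q`.
  have h1 : ∀ a, mixLik (G 0 a) (G 1 a) q' * W (postWeight h (G 0 a) (G 1 a) q)
      ≤ mixLik (G 0 a) (G 1 a) q' * W (postWeight h (G 0 a) (G 1 a) q') := by
    intro a
    rcases (mixLik_nonneg (hG 0 a) (hG 1 a) hq').eq_or_lt with h0 | h0
    · rw [← h0, zero_mul, zero_mul]
    · exact mul_le_mul_of_nonneg_left (hW (hmem a) (postWeight_mem_Icc hh (hG 0 a) (hG 1 a) hq')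
        (postWeight_mono hh (hG 0 a) (hG 1 a) hq hq' hqq h0)) h0.le
  -- Subtracting `W q` is free because both kernels sum to one; then each term is nonnegative, since
  -- the posterior moves from `q` in the direction of the sign of `G 1 a - G 0 a`.
  have h2 : 0 ≤ ∑ a, (G 1 a - G 0 a) * (W (postWeight h (G 0 a) (G 1 a) q) - W q) := by
    refine Finset.sum_nonneg fun a _ => ?_
    have hs := postWeight_sub_sign hh (hG 0 a) (hG 1 a) hq hq1
    rcases lt_trichotomy (G 0 a) (G 1 a) with hg | hg | hg
    · exact mul_nonneg (by linarith) (sub_nonneg.2 (hW hq (hmem a) (hs.1 hg)))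
    · rw [hg, sub_self, zero_mul]
    · exact mul_nonneg_of_nonpos_of_nonpos (by linarith)
        (sub_nonpos.2 (hW (hmem a) hq (hs.2 hg)))
  have h3 : ∑ a, (G 1 a - G 0 a) * (W (postWeight h (G 0 a) (G 1 a) q) - W q)
      = ∑ a, (G 1 a - G 0 a) * W (postWeight h (G 0 a) (G 1 a) q) := by
    simp only [mul_sub, Finset.sum_sub_distrib, ← Finset.sum_mul, hG1]
    ring
  have h4 : ∑ a, mixLik (G 0 a) (G 1 a) q' * W (postWeight h (G 0 a) (G 1 a) q)
      = ∑ a, mixLik (G 0 a) (G 1 a) q * W (postWeight h (G 0 a) (G 1 a) q)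
        + (q' - q) * ∑ a, (G 1 a - G 0 a) * W (postWeight h (G 0 a) (G 1 a) q) := by
    rw [Finset.mul_sum, ← Finset.sum_add_distrib]
    refine Finset.sum_congr rfl fun a _ => ?_
    unfold mixLik
    ring
  have h5 := mul_nonneg (sub_nonneg.2 hqq) (h3 ▸ h2)
  exact le_trans (by linarith) (Finset.sum_le_sum fun a _ => h1 a)

/-! ### Value iteration in the pre-change probability -/

section ValueIteration

variable {A : Type*} [Fintype A]

/-- The gain of proceeding rather than announcing when the gain afterwards is `W`. -/
noncomputable def proceedGain (h : ℝ → ℝ) (G : Fin 2 → A → ℝ) (p d f : ℝ) (W : ℝ → ℝ) (r : ℝ) : ℝ :=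
  f * (1 - p) * r - d * (1 - r)
    + ∑ a, mixLik (G 0 a) (G 1 a) (p * r) * W (postWeight h (G 0 a) (G 1 a) (p * r))

/-- The optimal gain over immediate announcement with at most `n` further observations. -/
noncomputable def gain (h : ℝ → ℝ) (G : Fin 2 → A → ℝ) (p d f : ℝ) : ℕ → ℝ → ℝ
  | 0 => fun _ => 0
  | n + 1 => fun r => max 0 (proceedGain h G p d f (gain h G p d f n) r)

variable {h : ℝ → ℝ} {G : Fin 2 → A → ℝ} {p d f : ℝ}

theorem mul_mem_Icc (hp0 : 0 ≤ p) (hp1 : p < 1) {r : ℝ} (hr : r ∈ Set.Icc (0 : ℝ) 1) :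
    p * r ∈ Set.Icc (0 : ℝ) 1 ∧ p * r < 1 := by
  have h1 : p * r ≤ p * 1 := mul_le_mul_of_nonneg_left hr.2 hp0
  exact ⟨⟨mul_nonneg hp0 hr.1, by linarith⟩, by linarith⟩

/-- The slope `d` comes from the expected delay cost `d (1 - r)` alone; the other terms are
nondecreasing. -/
theorem proceedGain_add_le (hh : IsOverlap h) (hG : ∀ x a, 0 ≤ G x a)
    (hG1 : ∀ x, ∑ a, G x a = 1) (hp0 : 0 ≤ p) (hp1 : p < 1) (hf : 0 ≤ f) {W : ℝ → ℝ}
    (hW : MonotoneOn W (Set.Icc 0 1)) {r r' : ℝ} (hr : r ∈ Set.Icc (0 : ℝ) 1)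
    (hr' : r' ∈ Set.Icc (0 : ℝ) 1) (hrr : r ≤ r') :
    proceedGain h G p d f W r + d * (r' - r) ≤ proceedGain h G p d f W r' := by
  have h1 := sum_mixLik_mul_postWeight_mono hh hG hG1 hW (mul_mem_Icc hp0 hp1 hr).1
    (mul_mem_Icc hp0 hp1 hr').1 (mul_le_mul_of_nonneg_left hrr hp0) (mul_mem_Icc hp0 hp1 hr).2
  have h2 : 0 ≤ f * (1 - p) * (r' - r) :=
    mul_nonneg (mul_nonneg hf (by linarith)) (by linarith)
  unfold proceedGain
  linarith

theorem gain_monotoneOn (hh : IsOverlap h) (hG : ∀ x a, 0 ≤ G x a)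
    (hG1 : ∀ x, ∑ a, G x a = 1) (hp0 : 0 ≤ p) (hp1 : p < 1) (hd : 0 ≤ d) (hf : 0 ≤ f) (n : ℕ) :
    MonotoneOn (gain h G p d f n) (Set.Icc 0 1) := by
  induction n with
  | zero => exact fun _ _ _ _ _ => le_rfl
  | succ n ih =>
    intro r hr r' hr' hrr
    have h1 := proceedGain_add_le (d := d) hh hG hG1 hp0 hp1 hf ih hr hr' hrr
    have h2 : 0 ≤ d * (r' - r) := mul_nonneg hd (by linarith)
    exact max_le_max le_rfl (by linarith)

theorem gain_nonneg (n : ℕ) (r : ℝ) : 0 ≤ gain h G p d f n r := by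
  cases n with
  | zero => exact le_rfl
  | succ n => exact le_max_left _ _

/-- The martingale property of posterior weights. -/
theorem sum_mixLik_mul_postWeight (hh : IsOverlap h) (hG : ∀ x a, 0 ≤ G x a)
    (hG1 : ∀ x, ∑ a, G x a = 1) {q : ℝ} (hq : q ∈ Set.Icc (0 : ℝ) 1) :
    ∑ a, mixLik (G 0 a) (G 1 a) q * postWeight h (G 0 a) (G 1 a) q = q := by
  simp only [mixLik_mul_postWeight hh (hG 0 _) (hG 1 _) hq, Finset.sum_sub_distrib,
    ← Finset.mul_sum, hG1]
  ring

theorem gain_le (hh : IsOverlap h) (hG : ∀ x a, 0 ≤ G x a)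
    (hG1 : ∀ x, ∑ a, G x a = 1) (hp0 : 0 ≤ p) (hp1 : p < 1) (hd : 0 ≤ d) (hf : 0 ≤ f) (n : ℕ) :
    ∀ r ∈ Set.Icc (0 : ℝ) 1, gain h G p d f n r ≤ f * r := by
  induction n with
  | zero => exact fun r hr => mul_nonneg hf hr.1
  | succ n ih =>
    intro r hr
    have hq := (mul_mem_Icc hp0 hp1 hr).1
    refine max_le (mul_nonneg hf hr.1) ?_
    have h1 : ∑ a, mixLik (G 0 a) (G 1 a) (p * r)
        * gain h G p d f n (postWeight h (G 0 a) (G 1 a) (p * r)) ≤ f * (p * r) := by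
      calc _ ≤ ∑ a, mixLik (G 0 a) (G 1 a) (p * r)
            * (f * postWeight h (G 0 a) (G 1 a) (p * r)) :=
            Finset.sum_le_sum fun a _ => mul_le_mul_of_nonneg_left
              (ih _ (postWeight_mem_Icc hh (hG 0 a) (hG 1 a) hq))
              (mixLik_nonneg (hG 0 a) (hG 1 a) hq)
        _ = f * ∑ a, mixLik (G 0 a) (G 1 a) (p * r)
            * postWeight h (G 0 a) (G 1 a) (p * r) := by
            rw [Finset.mul_sum]
            exact Finset.sum_congr rfl fun a _ => by ring
        _ = f * (p * r) := by rw [sum_mixLik_mul_postWeight hh hG hG1 hq]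
    have h2 : 0 ≤ d * (1 - r) := mul_nonneg hd (by linarith [hr.2])
    unfold proceedGain
    linarith

theorem abs_gain_le (hh : IsOverlap h) (hG : ∀ x a, 0 ≤ G x a)
    (hG1 : ∀ x, ∑ a, G x a = 1) (hp0 : 0 ≤ p) (hp1 : p < 1) (hd : 0 ≤ d) (hf : 0 ≤ f) (n : ℕ)
    (r : ℝ) (hr : r ∈ Set.Icc (0 : ℝ) 1) : |gain h G p d f n r| ≤ f := by
  rw [abs_of_nonneg (gain_nonneg n r)]
  exact (gain_le hh hG hG1 hp0 hp1 hd hf n r hr).trans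
    (mul_le_of_le_one_right hf hr.2)

theorem continuousOn_proceedGain (hh : IsOverlap h) (hG : ∀ x a, 0 ≤ G x a)
    (hp0 : 0 ≤ p) (hp1 : p < 1) {W : ℝ → ℝ} {c : ℝ}
    (hW : ContinuousOn W (Set.Icc 0 1)) (hWc : ∀ r ∈ Set.Icc (0 : ℝ) 1, |W r| ≤ c) :
    ContinuousOn (proceedGain h G p d f W) (Set.Icc 0 1) := by
  unfold proceedGain
  refine ContinuousOn.add (by fun_prop) (continuousOn_finsetSum _ fun a _ => ?_)
  exact (continuousOn_mixLik_mul_postWeight hh (hG 0 a) (hG 1 a) hW hWc).comp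
    (by fun_prop : ContinuousOn (fun r => p * r) (Set.Icc 0 1))
    fun r hr => (mul_mem_Icc hp0 hp1 hr).1

theorem continuousOn_gain (hh : IsOverlap h) (hG : ∀ x a, 0 ≤ G x a)
    (hG1 : ∀ x, ∑ a, G x a = 1) (hp0 : 0 ≤ p) (hp1 : p < 1) (hd : 0 ≤ d) (hf : 0 ≤ f) (n : ℕ) :
    ContinuousOn (gain h G p d f n) (Set.Icc 0 1) := by
  induction n with
  | zero => exact continuousOn_const
  | succ n ih =>
    exact continuousOn_const.sup (continuousOn_proceedGain hh hG hp0 hp1 ih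
      (abs_gain_le hh hG hG1 hp0 hp1 hd hf n))

/-- The beliefs at which proceeding brings no gain form an initial segment. -/
theorem exists_gain_threshold (hh : IsOverlap h) (hG : ∀ x a, 0 ≤ G x a)
    (hG1 : ∀ x, ∑ a, G x a = 1) (hp0 : 0 ≤ p) (hp1 : p < 1) (hd : 0 ≤ d) (hf : 0 ≤ f) :
    ∃ s ∈ Set.Icc (0 : ℝ) 1, ∀ r ∈ Set.Icc (0 : ℝ) 1,
      (r ≤ s → ∀ n, proceedGain h G p d f (gain h G p d f n) r ≤ -(d * (s - r))) ∧
      (s < r → ∃ n, 0 < proceedGain h G p d f (gain h G p d f n) r) := by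
  set K := {r ∈ Set.Icc (0 : ℝ) 1 | ∀ n, proceedGain h G p d f (gain h G p d f n) r ≤ 0} with hK
  have hKc : IsClosed K := by
    have : K = Set.Icc 0 1 ∩ ⋂ n, (Set.Icc 0 1 ∩
        proceedGain h G p d f (gain h G p d f n) ⁻¹' Set.Iic 0) := by
      ext r
      simp only [hK, Set.mem_ofPred_eq, Set.mem_inter_iff, Set.mem_iInter, Set.mem_preimage,
        Set.mem_Iic]
      exact ⟨fun ⟨a, b⟩ => ⟨a, fun n => ⟨a, b n⟩⟩, fun ⟨a, b⟩ => ⟨a, fun n => (b n).2⟩⟩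
    rw [this]
    refine isClosed_Icc.inter (isClosed_iInter fun n => ?_)
    exact (continuousOn_proceedGain hh hG hp0 hp1 (continuousOn_gain hh hG hG1 hp0 hp1 hd hf n)
      (abs_gain_le hh hG hG1 hp0 hp1 hd hf n)).preimage_isClosed_of_isClosed isClosed_Icc
      isClosed_Iic
  have h00 : (0 : ℝ) ∈ Set.Icc (0 : ℝ) 1 := ⟨le_rfl, zero_le_one⟩
  have hK0 : (0 : ℝ) ∈ K := by
    refine ⟨h00, fun n => ?_⟩
    have hz : h 0 = 0 := le_antisymm (by simpa using hh.le_mul 0 h00) (hh.nonneg 0 h00)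
    have hg0 : gain h G p d f n 0 = 0 :=
      le_antisymm (by simpa using gain_le hh hG hG1 hp0 hp1 hd hf n 0 h00) (gain_nonneg n 0)
    simp [proceedGain, postWeight, hz, hg0, hd]
  have hbdd : BddAbove K := ⟨1, fun r hr => hr.1.2⟩
  -- By closedness the supremum is attained, so announcing is also right at the threshold itself.
  -- The slope `d` then bounds the gain below it uniformly in `n`.
  have hsK : sSup K ∈ K := hKc.csSup_mem ⟨0, hK0⟩ hbdd
  refine ⟨sSup K, hsK.1, fun r hr => ⟨fun hrs n => ?_, fun hrs => ?_⟩⟩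
  · have h1 := proceedGain_add_le (d := d) hh hG hG1 hp0 hp1 hf
      (gain_monotoneOn hh hG hG1 hp0 hp1 hd hf n) hr hsK.1 hrs
    have h2 := hsK.2 n
    linarith
  · by_contra! hcon
    exact absurd (le_csSup hbdd ⟨hr, hcon⟩) (not_le.2 hrs)

end ValueIteration

/-! ### Action likelihoods -/

/-- `G` is a Markov kernel by which the steady-state actions depend on the belief. -/
structure QuantumAgent.IsActionKernel {X A : Type*} [Fintype X] [DecidableEq X] [Fintype A]
    [DecidableEq A] (M : QuantumAgent X A) (G : X → A → ℝ) : Prop where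
  nonneg : ∀ x a, 0 ≤ G x a
  sum_eq_one : ∀ x, ∑ a, G x a = 1
  steadyAction_eq : ∀ η ∈ stdSimplex ℝ X, ∀ a, M.steadyAction η a = ∑ x, η x * G x a

namespace QCDProtocol

variable {A Y : Type*} [Fintype A] [DecidableEq A] [MeasurableSpace Y]

/-- The product of the posterior weights of the two states at the observation `y`, times the
density of `y`, when the prior weights are `1 - q` and `q`. -/
noncomputable def overlapDensity (S : QCDProtocol A Y) (q : ℝ) (y : Y) : ℝ :=
  q * (1 - q) * (S.B 0 y * S.B 1 y) / ((1 - q) * S.B 0 y + q * S.B 1 y)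

/-- The integral of `overlapDensity`. -/
noncomputable def overlap (S : QCDProtocol A Y) (q : ℝ) : ℝ := ∫ y, S.overlapDensity q y ∂S.ν

theorem integrable_B (S : QCDProtocol A Y) (x : Fin 2) : Integrable (S.B x) S.ν := by
  refine ⟨(S.B_measurable x).aestronglyMeasurable, ?_⟩
  rw [hasFiniteIntegral_iff_ofReal (Eventually.of_forall (S.B_nonneg x)), S.B_lintegral]
  exact ENNReal.one_lt_top

theorem integral_B (S : QCDProtocol A Y) (x : Fin 2) : ∫ y, S.B x y ∂S.ν = 1 := by
  rw [integral_eq_lintegral_of_nonneg_ae (Eventually.of_forall (S.B_nonneg x))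
    (S.B_measurable x).aestronglyMeasurable, S.B_lintegral, ENNReal.toReal_one]

theorem overlapDensity_nonneg (S : QCDProtocol A Y) {q : ℝ} (hq : q ∈ Set.Icc (0 : ℝ) 1) (y : Y) :
    0 ≤ S.overlapDensity q y := by
  have h0 := S.B_nonneg 0 y
  have h1 := S.B_nonneg 1 y
  have h2 : 0 ≤ 1 - q := sub_nonneg.2 hq.2
  have h3 := hq.1
  unfold overlapDensity
  positivity

/-- Multiplying `(1 - q) B₀ + q B₁` by `q B₀ + (1 - q) B₁` exceeds `B₀ B₁` by `q (1 - q) (B₀ -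
B₁)²`. -/
theorem overlapDensity_le (S : QCDProtocol A Y) {q : ℝ} (hq : q ∈ Set.Icc (0 : ℝ) 1) (y : Y) :
    S.overlapDensity q y ≤ q * (1 - q) * (q * S.B 0 y + (1 - q) * S.B 1 y) := by
  have h0 := S.B_nonneg 0 y
  have h1 := S.B_nonneg 1 y
  have h2 : 0 ≤ 1 - q := sub_nonneg.2 hq.2
  have h3 := hq.1
  unfold overlapDensity
  rw [mul_div_assoc]
  refine mul_le_mul_of_nonneg_left (div_le_of_le_mul₀ (by positivity) (by positivity) ?_)
    (by positivity)
  have : 0 ≤ q * (1 - q) * (S.B 0 y - S.B 1 y) ^ 2 := by positivity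
  linarith

theorem integrable_overlapDensity (S : QCDProtocol A Y) {q : ℝ} (hq : q ∈ Set.Icc (0 : ℝ) 1) :
    Integrable (S.overlapDensity q) S.ν := by
  refine Integrable.mono' ((((S.integrable_B 0).const_mul q).add
    ((S.integrable_B 1).const_mul (1 - q))).const_mul (q * (1 - q))) ?_
    (Eventually.of_forall fun y => ?_)
  · have h0 := S.B_measurable 0
    have h1 := S.B_measurable 1
    unfold overlapDensity
    exact Measurable.aestronglyMeasurable (by fun_prop)
  · rw [Real.norm_eq_abs, abs_of_nonneg (S.overlapDensity_nonneg hq y)]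
    exact S.overlapDensity_le hq y

/-- All properties hold pointwise under the integral. Where both densities are positive, dividing
the density by `q` leaves `(1 - q) B₀ B₁ / ((1 - q) B₀ + q B₁)`, which is nonincreasing in `q`;
dividing by `1 - q` is the mirror case. -/
theorem isOverlap_overlap (S : QCDProtocol A Y) : IsOverlap S.overlap := by
  refine ⟨fun q hq => integral_nonneg (S.overlapDensity_nonneg hq), fun q hq => ?_,
    fun q hq q' hq' hqq => ?_, fun q hq q' hq' hqq => ?_⟩
  · calc S.overlap q ≤ ∫ y, q * (1 - q) * (q * S.B 0 y + (1 - q) * S.B 1 y) ∂S.ν :=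
        integral_mono (S.integrable_overlapDensity hq) ((((S.integrable_B 0).const_mul q).add
          ((S.integrable_B 1).const_mul (1 - q))).const_mul (q * (1 - q)))
          (S.overlapDensity_le hq)
      _ = q * (1 - q) := by
        rw [integral_const_mul, integral_add ((S.integrable_B 0).const_mul q)
          ((S.integrable_B 1).const_mul (1 - q)), integral_const_mul, integral_const_mul,
          integral_B, integral_B]
        ring
  · unfold overlap
    rw [← integral_mul_const, ← integral_mul_const]
    refine integral_mono ((S.integrable_overlapDensity hq').mul_const _)
      ((S.integrable_overlapDensity hq).mul_const _) fun y => ?_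
    rcases hq.1.eq_or_lt with h0 | hq0
    · simp [overlapDensity, ← h0]
    rcases (S.B_nonneg 0 y).eq_or_lt with h0 | h0
    · simp [overlapDensity, ← h0]
    rcases (S.B_nonneg 1 y).eq_or_lt with h1 | h1
    · simp [overlapDensity, ← h1]
    have hm : ∀ t ∈ Set.Icc (0 : ℝ) 1, 0 < t → 0 < (1 - t) * S.B 0 y + t * S.B 1 y := by
      intro t ht ht0
      have : 0 ≤ 1 - t := sub_nonneg.2 ht.2
      positivity
    have hq0' := hq0.trans_le hqq
    simp only [overlapDensity]
    rw [div_mul_eq_mul_div, div_mul_eq_mul_div, div_le_div_iff₀ (hm q' hq' hq0') (hm q hq hq0)]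
    have : 0 ≤ q * q' * (S.B 0 y * S.B 1 y) * (S.B 1 y * (q' - q)) :=
      mul_nonneg (by positivity) (mul_nonneg h1.le (by linarith))
    linarith
  · unfold overlap
    rw [← integral_mul_const, ← integral_mul_const]
    refine integral_mono ((S.integrable_overlapDensity hq).mul_const _)
      ((S.integrable_overlapDensity hq').mul_const _) fun y => ?_
    rcases hq'.2.eq_or_lt with h0 | hq0'
    · simp [overlapDensity, h0]
    rcases (S.B_nonneg 0 y).eq_or_lt with h0 | h0
    · simp [overlapDensity, ← h0]
    rcases (S.B_nonneg 1 y).eq_or_lt with h1 | h1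
    · simp [overlapDensity, ← h1]
    have hm : ∀ t ∈ Set.Icc (0 : ℝ) 1, t < 1 → 0 < (1 - t) * S.B 0 y + t * S.B 1 y := by
      intro t ht ht0
      have h2 : 0 < 1 - t := sub_pos.2 ht0
      have h3 := ht.1
      positivity
    have hq0 := hqq.trans_lt hq0'
    simp only [overlapDensity]
    rw [div_mul_eq_mul_div, div_mul_eq_mul_div, div_le_div_iff₀ (hm q hq hq0) (hm q' hq' hq0')]
    have : 0 ≤ (1 - q) * (1 - q') * (S.B 0 y * S.B 1 y) * (S.B 0 y * (q' - q)) :=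
      mul_nonneg (mul_nonneg (mul_nonneg (by linarith) (by linarith)) (by positivity))
        (mul_nonneg h0.le (by linarith))
    linarith

/-! ### The predicted belief -/

theorem predict_one (S : QCDProtocol A Y) (π : Fin 2 → ℝ) : S.predict π 1 = S.p * π 1 := by
  simp [predict, trans, Matrix.mulVec, dotProduct, Fin.sum_univ_two]

theorem predict_zero (S : QCDProtocol A Y) {π : Fin 2 → ℝ} (hπ : π ∈ stdSimplex ℝ (Fin 2)) :
    S.predict π 0 = 1 - S.p * π 1 := by
  have h := hπ.2
  rw [Fin.sum_univ_two] at h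
  simp [predict, trans, Matrix.mulVec, dotProduct, Fin.sum_univ_two]
  linarith

theorem weight_mem_Icc {π : Fin 2 → ℝ} (hπ : π ∈ stdSimplex ℝ (Fin 2)) :
    π 1 ∈ Set.Icc (0 : ℝ) 1 := by
  have h := hπ.2
  rw [Fin.sum_univ_two] at h
  exact ⟨hπ.1 1, by linarith [hπ.1 0]⟩

theorem predict_weight_mem_Icc (S : QCDProtocol A Y) {π : Fin 2 → ℝ}
    (hπ : π ∈ stdSimplex ℝ (Fin 2)) : S.p * π 1 ∈ Set.Icc (0 : ℝ) 1 :=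
  (mul_mem_Icc S.p_nonneg S.p_lt_one (weight_mem_Icc hπ)).1

theorem predict_nonneg (S : QCDProtocol A Y) {π : Fin 2 → ℝ} (hπ : π ∈ stdSimplex ℝ (Fin 2))
    (x : Fin 2) : 0 ≤ S.predict π x := by
  have := S.predict_weight_mem_Icc hπ
  fin_cases x
  · simpa [S.predict_zero hπ] using this.2
  · simpa [S.predict_one] using this.1

theorem obsNorm_eq (S : QCDProtocol A Y) {π : Fin 2 → ℝ} (hπ : π ∈ stdSimplex ℝ (Fin 2)) (y : Y) :
    S.obsNorm π y = (1 - S.p * π 1) * S.B 0 y + S.p * π 1 * S.B 1 y := by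
  rw [obsNorm, Fin.sum_univ_two, S.predict_zero hπ, S.predict_one]
  ring

theorem predict_mul_B_eq_zero (S : QCDProtocol A Y) {π : Fin 2 → ℝ}
    (hπ : π ∈ stdSimplex ℝ (Fin 2)) {y : Y} (h : S.obsNorm π y = 0) (x : Fin 2) :
    S.predict π x * S.B x y = 0 := by
  have h' := (Finset.sum_eq_zero_iff_of_nonneg (s := Finset.univ)
    (f := fun x => S.B x y * S.predict π x)
    (fun x _ => mul_nonneg (S.B_nonneg x y) (S.predict_nonneg hπ x))).1 h x (Finset.mem_univ x)
  rw [mul_comm]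
  exact h'

theorem privateBelief_mem (S : QCDProtocol A Y) {π : Fin 2 → ℝ} (hπ : π ∈ stdSimplex ℝ (Fin 2))
    {y : Y} (h : S.obsNorm π y ≠ 0) : S.privateBelief π y ∈ stdSimplex ℝ (Fin 2) := by
  refine ⟨fun x => div_nonneg (mul_nonneg (S.B_nonneg x y) (S.predict_nonneg hπ x))
    (Finset.sum_nonneg fun x _ => mul_nonneg (S.B_nonneg x y) (S.predict_nonneg hπ x)), ?_⟩
  simp only [privateBelief, ← Finset.sum_div]
  exact div_self h

variable {S : QCDProtocol A Y} {G : Fin 2 → A → ℝ} {π : Fin 2 → ℝ}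

/-- The numerator of the posterior weights after an action. -/
noncomputable def postNum (S : QCDProtocol A Y) (G : Fin 2 → A → ℝ) (π : Fin 2 → ℝ) (a : A) :
    Fin 2 → ℝ :=
  ![(1 - S.p * π 1) * G 0 a + S.overlap (S.p * π 1) * (G 1 a - G 0 a),
    S.p * π 1 * G 1 a - S.overlap (S.p * π 1) * (G 1 a - G 0 a)]

/-- The integrand of `postNum`. -/
noncomputable def postNumDensity (S : QCDProtocol A Y) (G : Fin 2 → A → ℝ) (π : Fin 2 → ℝ) (a : A)
    (y : Y) : Fin 2 → ℝ :=
  ![(1 - S.p * π 1) * G 0 a * S.B 0 y + S.overlapDensity (S.p * π 1) y * (G 1 a - G 0 a),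
    S.p * π 1 * G 1 a * S.B 1 y - S.overlapDensity (S.p * π 1) y * (G 1 a - G 0 a)]

theorem humanAction_eq (hG : S.agent.IsActionKernel G) (hπ : π ∈ stdSimplex ℝ (Fin 2)) {y : Y}
    (h : S.obsNorm π y ≠ 0) (a : A) : S.humanAction π y a
      = ((1 - S.p * π 1) * S.B 0 y * G 0 a + S.p * π 1 * S.B 1 y * G 1 a) / S.obsNorm π y := by
  rw [humanAction, hG.steadyAction_eq _ (S.privateBelief_mem hπ h), Fin.sum_univ_two]
  simp only [privateBelief, S.predict_zero hπ, S.predict_one]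
  field_simp

theorem humanAction_nonneg (hG : S.agent.IsActionKernel G) (hπ : π ∈ stdSimplex ℝ (Fin 2)) {y : Y}
    (h : S.obsNorm π y ≠ 0) (a : A) : 0 ≤ S.humanAction π y a := by
  rw [humanAction, hG.steadyAction_eq _ (S.privateBelief_mem hπ h)]
  exact Finset.sum_nonneg fun x _ => mul_nonneg ((S.privateBelief_mem hπ h).1 x) (hG.nonneg x a)

/-- The overlap is the joint weight that Bayes' rule exchanges between the two states. At
observations of density zero the private belief is the default `0 / 0`, and both sides vanish. -/
theorem predict_mul_humanAction_mul_B (hG : S.agent.IsActionKernel G)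
    (hπ : π ∈ stdSimplex ℝ (Fin 2)) (a : A) (x : Fin 2) (y : Y) :
    S.predict π x * (S.humanAction π y a * S.B x y) = S.postNumDensity G π a y x := by
  by_cases h : S.obsNorm π y = 0
  · have h1 : ∀ x, S.predict π x * (S.humanAction π y a * S.B x y) = 0 := by
      intro x
      rw [mul_left_comm, S.predict_mul_B_eq_zero hπ h, mul_zero]
    have h0 := S.predict_mul_B_eq_zero hπ h 0
    have h2 := S.predict_mul_B_eq_zero hπ h 1
    rw [S.predict_zero hπ] at h0
    rw [S.predict_one] at h2
    rw [h1]
    have h' := h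
    rw [S.obsNorm_eq hπ] at h'
    have hD : S.overlapDensity (S.p * π 1) y = 0 := by rw [overlapDensity, h', div_zero]
    fin_cases x
    · simp only [postNumDensity, hD]
      simp [mul_right_comm _ (G 0 a), h0]
    · simp only [postNumDensity, hD]
      simp [mul_right_comm _ (G 1 a), h2]
  · rw [humanAction_eq hG hπ h]
    have h' := h
    rw [S.obsNorm_eq hπ] at h' ⊢
    fin_cases x
    · simp [postNumDensity, overlapDensity, S.predict_zero hπ]
      field_simp
      ring
    · simp [postNumDensity, overlapDensity, S.predict_one]
      field_simp
      ring

theorem integrable_postNumDensity (hπ : π ∈ stdSimplex ℝ (Fin 2)) (a : A) (x : Fin 2) :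
    Integrable (fun y => S.postNumDensity G π a y x) S.ν := by
  have h := S.integrable_overlapDensity (S.predict_weight_mem_Icc hπ)
  fin_cases x
  · exact ((S.integrable_B 0).const_mul _).add (h.mul_const _)
  · exact ((S.integrable_B 1).const_mul _).sub (h.mul_const _)

theorem integral_postNumDensity (hπ : π ∈ stdSimplex ℝ (Fin 2)) (a : A) (x : Fin 2) :
    ∫ y, S.postNumDensity G π a y x ∂S.ν = S.postNum G π a x := by
  have h := S.integrable_overlapDensity (S.predict_weight_mem_Icc hπ)
  fin_cases x
  · refine (integral_add ((S.integrable_B 0).const_mul _) (h.mul_const _)).trans ?_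
    rw [integral_const_mul, integral_mul_const, integral_B]
    simp [postNum, overlap]
  · refine (integral_sub ((S.integrable_B 1).const_mul _) (h.mul_const _)).trans ?_
    rw [integral_const_mul, integral_mul_const, integral_B]
    simp [postNum, overlap]

theorem actionLik_mul_predict (hG : S.agent.IsActionKernel G) (hπ : π ∈ stdSimplex ℝ (Fin 2))
    (a : A) (x : Fin 2) : S.actionLik x π a * S.predict π x = S.postNum G π a x := by
  rw [mul_comm, actionLik, ← integral_const_mul, ← integral_postNumDensity hπ]
  simp only [predict_mul_humanAction_mul_B hG hπ]

theorem actionNorm_eq (hG : S.agent.IsActionKernel G) (hπ : π ∈ stdSimplex ℝ (Fin 2)) (a : A) :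
    S.actionNorm π a = mixLik (G 0 a) (G 1 a) (S.p * π 1) := by
  simp only [actionNorm, actionLik_mul_predict hG hπ, Fin.sum_univ_two, postNum, mixLik]
  simp

theorem update_one (hG : S.agent.IsActionKernel G) (hπ : π ∈ stdSimplex ℝ (Fin 2)) (a : A) :
    S.update π a 1 = postWeight S.overlap (G 0 a) (G 1 a) (S.p * π 1) := by
  simp only [update, actionLik_mul_predict hG hπ, actionNorm_eq hG hπ, postNum, postWeight]
  simp

theorem postNum_nonneg (hG : S.agent.IsActionKernel G) (hπ : π ∈ stdSimplex ℝ (Fin 2)) (a : A)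
    (x : Fin 2) : 0 ≤ S.postNum G π a x := by
  have hq := S.predict_weight_mem_Icc hπ
  have h1 := S.isOverlap_overlap.post_num_nonneg (hG.nonneg 0 a) (hG.nonneg 1 a) hq
  have h2 := S.isOverlap_overlap.post_num_le (hG.nonneg 0 a) (hG.nonneg 1 a) hq
  unfold mixLik at h2
  fin_cases x
  · simp [postNum]
    linarith
  · simpa [postNum] using h1

theorem actionNorm_nonneg (hG : S.agent.IsActionKernel G) (hπ : π ∈ stdSimplex ℝ (Fin 2)) (a : A) :
    0 ≤ S.actionNorm π a := by
  rw [actionNorm_eq hG hπ]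
  exact mixLik_nonneg (hG.nonneg 0 a) (hG.nonneg 1 a) (S.predict_weight_mem_Icc hπ)

theorem sum_actionNorm (hG : S.agent.IsActionKernel G) (hπ : π ∈ stdSimplex ℝ (Fin 2)) :
    ∑ a, S.actionNorm π a = 1 := by
  simp only [actionNorm_eq hG hπ, mixLik, Finset.sum_add_distrib, ← Finset.mul_sum,
    hG.sum_eq_one]
  ring

theorem actionNorm_mul_update (hG : S.agent.IsActionKernel G) (hπ : π ∈ stdSimplex ℝ (Fin 2))
    (a : A) (x : Fin 2) :
    S.actionNorm π a * S.update π a x = S.actionLik x π a * S.predict π x := by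
  by_cases h : S.actionNorm π a = 0
  · have h' := (Finset.sum_eq_zero_iff_of_nonneg (s := Finset.univ)
      (f := fun x => S.actionLik x π a * S.predict π x) (fun x _ => by
        rw [actionLik_mul_predict hG hπ]; exact postNum_nonneg hG hπ a x)).1 h x (Finset.mem_univ x)
    rw [h, zero_mul]
    exact h'.symm
  · rw [update, mul_div_cancel₀ _ h]

theorem update_mem (hG : S.agent.IsActionKernel G) (hπ : π ∈ stdSimplex ℝ (Fin 2)) {a : A}
    (h : S.actionNorm π a ≠ 0) : S.update π a ∈ stdSimplex ℝ (Fin 2) := by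
  refine ⟨fun x => div_nonneg ?_ (actionNorm_nonneg hG hπ a), ?_⟩
  · rw [actionLik_mul_predict hG hπ]
    exact postNum_nonneg hG hπ a x
  · simp only [update, ← Finset.sum_div]
    exact div_self h

/-- Turns the integral in the law of the protocol into the belief update. At null observations the
sign of `humanAction` is unknown, but either the predicted weight or `B x y` is zero, so truncation
by `ofReal` is harmless. -/
theorem ofReal_predict_mul_lintegral (hG : S.agent.IsActionKernel G)
    (hπ : π ∈ stdSimplex ℝ (Fin 2)) (a : A) (x : Fin 2) :
    ENNReal.ofReal (S.predict π x) *
        ∫⁻ y, ENNReal.ofReal (S.humanAction π y a) * ENNReal.ofReal (S.B x y) ∂S.ν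
      = ENNReal.ofReal (S.actionNorm π a * S.update π a x) := by
  rcases (S.predict_nonneg hπ x).eq_or_lt with h0 | h0
  · rw [actionNorm_mul_update hG hπ, ← h0]
    simp
  have hpt : ∀ y, 0 ≤ S.humanAction π y a * S.B x y ∧
      ENNReal.ofReal (S.humanAction π y a) * ENNReal.ofReal (S.B x y)
        = ENNReal.ofReal (S.humanAction π y a * S.B x y) := by
    intro y
    by_cases h : S.obsNorm π y = 0
    · have hB : S.B x y = 0 :=
        (mul_eq_zero.1 (S.predict_mul_B_eq_zero hπ h x)).resolve_left h0.ne'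
      simp [hB]
    · have := humanAction_nonneg hG hπ h a
      exact ⟨mul_nonneg this (S.B_nonneg x y), (ENNReal.ofReal_mul this).symm⟩
  have hnn : ∀ y, 0 ≤ S.postNumDensity G π a y x := by
    intro y
    rw [← predict_mul_humanAction_mul_B hG hπ]
    exact mul_nonneg h0.le (hpt y).1
  rw [actionNorm_mul_update hG hπ, actionLik_mul_predict hG hπ, ← integral_postNumDensity hπ,
    ofReal_integral_eq_lintegral_ofReal (integrable_postNumDensity hπ a x)
      (Eventually.of_forall hnn), ← lintegral_const_mul' _ _ ENNReal.ofReal_ne_top]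
  refine lintegral_congr fun y => ?_
  rw [(hpt y).2, ← ENNReal.ofReal_mul h0.le, predict_mul_humanAction_mul_B hG hπ]

end QCDProtocol

/-! ### The cost of a policy as a sum over histories -/

/-- Histories carry the latest action first, so the appended letter is the first action taken. This
is the first-step decomposition behind the Bellman equation. -/
theorem ENNReal.tsum_list_snoc {A : Type*} [Fintype A] (F : List A → ℝ≥0∞) :
    ∑' h, F h = F [] + ∑ a, ∑' h, F (h ++ [a]) := by
  let e : Unit ⊕ (A × List A) → List A := Sum.elim (fun _ => []) fun p => p.2 ++ [p.1]
  have he : Function.Bijective e := by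
    constructor
    · rintro (_ | ⟨a, h⟩) (_ | ⟨b, l⟩) hab
      · rfl
      · simp [e] at hab
      · simp [e] at hab
      · obtain ⟨h1, h2⟩ := List.append_inj' hab rfl
        simp only [List.cons.injEq, and_true] at h2
        exact congrArg Sum.inr (Prod.ext h2 h1)
    · intro l
      rcases List.eq_nil_or_concat l with rfl | ⟨h, a, rfl⟩
      · exact ⟨Sum.inl (), rfl⟩
      · exact ⟨Sum.inr (a, h), by simp [e]⟩
  rw [← (Equiv.ofBijective e he).tsum_eq F,
    Summable.tsum_sum ENNReal.summable ENNReal.summable, tsum_fintype, ENNReal.tsum_prod',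
    tsum_fintype]
  simp [e]

/-- The policy `u` has not announced along the history `h` (latest action first). -/
def IsAlive {A : Type*} (u : List A → Decision) : List A → Prop
  | [] => u [] ≠ Decision.announce
  | a :: h => u (a :: h) ≠ Decision.announce ∧ IsAlive u h

/-- The policy `u` announces for the first time at the end of the history `h`. -/
def StopsAt {A : Type*} (u : List A → Decision) : List A → Prop
  | [] => u [] = Decision.announce
  | a :: h => u (a :: h) = Decision.announce ∧ IsAlive u h

theorem isAlive_snoc {A : Type*} (u : List A → Decision) (h : List A) (a : A) :
    IsAlive u (h ++ [a]) ↔ u [] ≠ Decision.announce ∧ IsAlive (fun l => u (l ++ [a])) h := by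
  induction h with
  | nil => simp [IsAlive, and_comm]
  | cons b h ih =>
    simp only [List.cons_append, IsAlive, ih]
    tauto

theorem stopsAt_snoc {A : Type*} (u : List A → Decision) (h : List A) (a : A) :
    StopsAt u (h ++ [a]) ↔ u [] ≠ Decision.announce ∧ StopsAt (fun l => u (l ++ [a])) h := by
  cases h with
  | nil => simp [IsAlive, StopsAt, and_comm]
  | cons b h =>
    simp only [List.cons_append, StopsAt, isAlive_snoc]
    tauto

namespace QCDProtocol

variable {A Y : Type*} [Fintype A] [DecidableEq A] [MeasurableSpace Y]

/-- The probability of a history of actions. -/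
noncomputable def historyProb (S : QCDProtocol A Y) (π : Fin 2 → ℝ) : List A → ℝ
  | [] => 1
  | a :: h => S.historyProb π h * S.actionNorm (S.publicBelief π h) a

/-- The joint probability of a history of actions and the state at its end. -/
noncomputable def historyMass (S : QCDProtocol A Y) (π : Fin 2 → ℝ) (h : List A) (j : Fin 2) :
    ℝ≥0∞ :=
  ENNReal.ofReal (S.historyProb π h * S.publicBelief π h j)

theorem publicBelief_snoc (S : QCDProtocol A Y) (π : Fin 2 → ℝ) (h : List A) (a : A) :
    S.publicBelief π (h ++ [a]) = S.publicBelief (S.update π a) h := by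
  induction h with
  | nil => rfl
  | cons b h ih => simp only [List.cons_append, publicBelief, ih]

theorem historyProb_snoc (S : QCDProtocol A Y) (π : Fin 2 → ℝ) (h : List A) (a : A) :
    S.historyProb π (h ++ [a]) = S.actionNorm π a * S.historyProb (S.update π a) h := by
  induction h with
  | nil => simp [historyProb, publicBelief]
  | cons b h ih => simp only [List.cons_append, historyProb, ih, publicBelief_snoc, mul_assoc]

theorem historyProb_nonneg_and_mem {S : QCDProtocol A Y} {G : Fin 2 → A → ℝ}
    (hG : S.agent.IsActionKernel G) {π : Fin 2 → ℝ} (hπ : π ∈ stdSimplex ℝ (Fin 2)) (h : List A) :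
    0 ≤ S.historyProb π h ∧
      (S.historyProb π h ≠ 0 → S.publicBelief π h ∈ stdSimplex ℝ (Fin 2)) := by
  induction h with
  | nil => exact ⟨zero_le_one, fun _ => hπ⟩
  | cons a h ih =>
    simp only [historyProb, publicBelief]
    by_cases h0 : S.historyProb π h = 0
    · simp [h0]
    · have hm := ih.2 h0
      refine ⟨mul_nonneg ih.1 (actionNorm_nonneg hG hm a), fun h1 => ?_⟩
      exact update_mem hG hm (right_ne_zero_of_mul h1)

theorem historyMass_snoc {S : QCDProtocol A Y} {G : Fin 2 → A → ℝ}
    (hG : S.agent.IsActionKernel G) {π : Fin 2 → ℝ} (hπ : π ∈ stdSimplex ℝ (Fin 2)) (h : List A)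
    (a : A) (j : Fin 2) :
    S.historyMass π (h ++ [a]) j
      = ENNReal.ofReal (S.actionNorm π a) * S.historyMass (S.update π a) h j := by
  rw [historyMass, historyProb_snoc, publicBelief_snoc, mul_assoc,
    ENNReal.ofReal_mul (actionNorm_nonneg hG hπ a), historyMass]

open Classical in
/-- The expected cost incurred by the policy `u` at the end of the history `h`. -/
noncomputable def stageCost (S : QCDProtocol A Y) (π : Fin 2 → ℝ) (u : List A → Decision)
    (h : List A) : ℝ≥0∞ :=
  (if IsAlive u h then ENNReal.ofReal S.d * S.historyMass π h 0 else 0)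
    + if StopsAt u h then ENNReal.ofReal S.f * S.historyMass π h 1 else 0

/-- The expected cost of the policy `u`. -/
noncomputable def policyCost (S : QCDProtocol A Y) (π : Fin 2 → ℝ) (u : List A → Decision) :
    ℝ≥0∞ :=
  ∑' h, S.stageCost π u h

/-- The expected cost of the policy `u` incurred in the first `n` steps. -/
noncomputable def truncCost (S : QCDProtocol A Y) (n : ℕ) (π : Fin 2 → ℝ)
    (u : List A → Decision) : ℝ≥0∞ :=
  ∑' h : List A, if h.length < n then S.stageCost π u h else 0

variable {S : QCDProtocol A Y} {G : Fin 2 → A → ℝ} {π : Fin 2 → ℝ} {u : List A → Decision}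

theorem stageCost_snoc_of_announce (hu : u [] = Decision.announce) (h : List A) (a : A) :
    S.stageCost π u (h ++ [a]) = 0 := by
  simp [stageCost, isAlive_snoc, stopsAt_snoc, hu]

theorem stageCost_snoc_of_proceed (hG : S.agent.IsActionKernel G)
    (hπ : π ∈ stdSimplex ℝ (Fin 2)) (hu : u [] ≠ Decision.announce) (h : List A) (a : A) :
    S.stageCost π u (h ++ [a])
      = ENNReal.ofReal (S.actionNorm π a) * S.stageCost (S.update π a) (fun l => u (l ++ [a])) h := by
  have h1 : IsAlive u (h ++ [a]) ↔ IsAlive (fun l => u (l ++ [a])) h := by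
    simp [isAlive_snoc, hu]
  have h2 : StopsAt u (h ++ [a]) ↔ StopsAt (fun l => u (l ++ [a])) h := by
    simp [stopsAt_snoc, hu]
  by_cases c1 : IsAlive (fun l => u (l ++ [a])) h <;>
    by_cases c2 : StopsAt (fun l => u (l ++ [a])) h <;>
    simp [stageCost, h1, h2, c1, c2, historyMass_snoc hG hπ, mul_add, mul_left_comm]

theorem stageCost_nil_of_announce (hu : u [] = Decision.announce) :
    S.stageCost π u [] = S.QAnnounce π := by
  simp [stageCost, IsAlive, StopsAt, hu, historyMass, historyProb, publicBelief, QAnnounce,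
    ENNReal.ofReal_mul S.f_nonneg]

theorem stageCost_nil_of_proceed (hu : u [] ≠ Decision.announce) :
    S.stageCost π u [] = ENNReal.ofReal (S.d * π 0) := by
  simp [stageCost, IsAlive, StopsAt, hu, historyMass, historyProb, publicBelief,
    ENNReal.ofReal_mul S.d_pos.le]

theorem policyCost_of_announce (hu : u [] = Decision.announce) :
    S.policyCost π u = S.QAnnounce π := by
  simp [policyCost, ENNReal.tsum_list_snoc, stageCost_snoc_of_announce hu,
    stageCost_nil_of_announce hu]

theorem policyCost_of_proceed (hG : S.agent.IsActionKernel G) (hπ : π ∈ stdSimplex ℝ (Fin 2))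
    (hu : u [] ≠ Decision.announce) :
    S.policyCost π u = ENNReal.ofReal (S.d * π 0)
      + ∑ a, S.policyCost (S.update π a) (fun l => u (l ++ [a]))
        * ENNReal.ofReal (S.actionNorm π a) := by
  simp only [policyCost]
  rw [ENNReal.tsum_list_snoc, stageCost_nil_of_proceed hu]
  simp only [stageCost_snoc_of_proceed hG hπ hu, ENNReal.tsum_mul_left, mul_comm]

theorem truncCost_zero : S.truncCost 0 π u = 0 := by simp [truncCost]

theorem truncCost_succ_of_announce (n : ℕ) (hu : u [] = Decision.announce) :
    S.truncCost (n + 1) π u = S.QAnnounce π := by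
  simp [truncCost, ENNReal.tsum_list_snoc, stageCost_snoc_of_announce hu,
    stageCost_nil_of_announce hu]

theorem truncCost_succ_of_proceed (hG : S.agent.IsActionKernel G) (hπ : π ∈ stdSimplex ℝ (Fin 2))
    (n : ℕ) (hu : u [] ≠ Decision.announce) :
    S.truncCost (n + 1) π u = ENNReal.ofReal (S.d * π 0)
      + ∑ a, S.truncCost n (S.update π a) (fun l => u (l ++ [a]))
        * ENNReal.ofReal (S.actionNorm π a) := by
  have h1 : ∀ (h : List A) (a : A), (if (h ++ [a]).length < n + 1
      then S.stageCost π u (h ++ [a]) else 0) = ENNReal.ofReal (S.actionNorm π a)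
        * if h.length < n then S.stageCost (S.update π a) (fun l => u (l ++ [a])) h else 0 := by
    intro h a
    simp [stageCost_snoc_of_proceed hG hπ hu, mul_ite]
  simp only [truncCost]
  rw [ENNReal.tsum_list_snoc, List.length_nil, if_pos n.succ_pos, stageCost_nil_of_proceed hu]
  simp only [h1, ENNReal.tsum_mul_left, mul_comm]

theorem truncCost_le_policyCost (n : ℕ) : S.truncCost n π u ≤ S.policyCost π u := by
  refine ENNReal.tsum_le_tsum fun h => ?_
  split_ifs <;> simp

theorem policyCost_le_of_truncCost_le {c : ℝ≥0∞} (h : ∀ n, S.truncCost n π u ≤ c) :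
    S.policyCost π u ≤ c := by
  rw [policyCost, ENNReal.tsum_eq_iSup_sum]
  refine iSup_le fun s => ?_
  obtain ⟨n, hn⟩ : ∃ n, ∀ l ∈ s, l.length < n :=
    ⟨s.sup List.length + 1, fun l hl => Nat.lt_succ_of_le (Finset.le_sup hl)⟩
  calc ∑ l ∈ s, S.stageCost π u l
      = ∑ l ∈ s, if l.length < n then S.stageCost π u l else 0 :=
        Finset.sum_congr rfl fun l hl => (if_pos (hn l hl)).symm
    _ ≤ S.truncCost n π u := ENNReal.sum_le_tsum s
    _ ≤ c := h n

end QCDProtocol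

/-! ### Announcement and change times -/

theorem coe_lt_firstTime {q : ℕ → Prop} {n : ℕ} :
    (n : ℕ∞) < firstTime q ↔ ∀ k ≤ n, ¬ q k := by
  rw [firstTime, ← ENat.add_one_le_iff (ENat.natCast_ne_top n)]
  simp only [le_iInf_iff]
  constructor
  · intro h k hk hq
    have h1 := h k hq
    have : n + 1 ≤ k := by exact_mod_cast h1
    omega
  · intro h k hq
    have : n + 1 ≤ k := by
      by_contra! hlt
      exact h k (by omega) hq
    exact_mod_cast this

theorem firstTime_le_coe {q : ℕ → Prop} {n : ℕ} : firstTime q ≤ n ↔ ∃ k ≤ n, q k := by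
  rw [← not_lt, coe_lt_firstTime]
  push Not
  rfl

theorem firstTime_eq_coe {q : ℕ → Prop} {n : ℕ} :
    firstTime q = n ↔ q n ∧ ∀ k < n, ¬ q k := by
  constructor
  · intro h
    have h2 : ∀ k < n, ¬ q k := fun k hk =>
      coe_lt_firstTime.1 (by rw [h]; exact_mod_cast hk) k le_rfl
    obtain ⟨k, hk, hq⟩ := firstTime_le_coe.1 h.le
    rcases hk.eq_or_lt with rfl | hk
    · exact ⟨hq, h2⟩
    · exact absurd hq (h2 k hk)
  · rintro ⟨h1, h2⟩
    refine le_antisymm (firstTime_le_coe.2 ⟨n, le_rfl, h1⟩) ?_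
    simp only [firstTime, le_iInf_iff]
    intro k hk
    by_contra! hlt
    exact h2 k (by exact_mod_cast hlt) hk

open Classical in
-- Writes the delay as the number of times at which the change has occurred and no announcement has
-- been made.
theorem ENat.toENNReal_sub_eq_tsum (s t : ℕ∞) :
    ((t - s : ℕ∞) : ℝ≥0∞) = ∑' n : ℕ, if s ≤ n ∧ (n : ℕ∞) < t then 1 else 0 := by
  have h1 : ∑' n : ℕ, (if s ≤ n ∧ (n : ℕ∞) < t then (1 : ℝ≥0∞) else 0)
      = (({n : ℕ | s ≤ n ∧ (n : ℕ∞) < t}.encard : ℕ∞) : ℝ≥0∞) := by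
    rw [← ENNReal.tsum_set_one, tsum_subtype _ fun _ => (1 : ℝ≥0∞)]
    exact tsum_congr fun n => by simp [Set.indicator_apply]
  rw [h1]
  congr 1
  induction s with
  | top =>
    have : {n : ℕ | (⊤ : ℕ∞) ≤ n ∧ (n : ℕ∞) < t} = ∅ := by ext n; simp
    rw [this]
    simp
  | coe m =>
    induction t with
    | top =>
      have : {n : ℕ | (m : ℕ∞) ≤ n ∧ (n : ℕ∞) < ⊤} = Set.Ici m := by ext n; simp
      rw [this, (Set.Ici_infinite m).encard_eq]
      simp
    | coe k =>
      have : {n : ℕ | (m : ℕ∞) ≤ n ∧ (n : ℕ∞) < k} = ↑(Finset.Ico m k) := by ext n; simp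
      rw [this, Set.encard_coe_eq_coe_finsetCard, Nat.card_Ico]
      simp

theorem Fin.ne_zero_iff_eq_one_of_two (i : Fin 2) : i ≠ 0 ↔ i = 1 := by omega

theorem length_actionHistory {A : Type*} (b : ℕ → A) (n : ℕ) : (actionHistory b n).length = n := by
  induction n with
  | zero => rfl
  | succ n ih => simp [actionHistory, ih]

theorem actionHistory_eq_iff {A : Type*} (b b' : ℕ → A) (n : ℕ) :
    actionHistory b n = actionHistory b' n ↔ ∀ k < n, b k = b' k := by
  induction n with
  | zero => simp [actionHistory]
  | succ n ih =>
    simp only [actionHistory, List.cons.injEq, ih]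
    constructor
    · rintro ⟨h1, h2⟩ k hk
      rcases (Nat.lt_succ_iff.1 hk).eq_or_lt with rfl | hk
      · exact h1
      · exact h2 k hk
    · exact fun h => ⟨h n n.lt_succ_self, fun k hk => h k (hk.trans n.lt_succ_self)⟩

theorem exists_actionHistory_eq {A : Type*} [Nonempty A] (h : List A) :
    ∃ b : ℕ → A, actionHistory b h.length = h := by
  induction h with
  | nil => exact ⟨fun _ => Classical.arbitrary A, rfl⟩
  | cons a h ih =>
    obtain ⟨b, hb⟩ := ih
    refine ⟨Function.update b h.length a, ?_⟩
    simp only [List.length_cons, actionHistory, Function.update_self]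
    congr 1
    rw [← hb, length_actionHistory, actionHistory_eq_iff]
    exact fun k hk => Function.update_of_ne hk.ne _ _

theorem isAlive_actionHistory {A : Type*} (u : List A → Decision) (b : ℕ → A) (n : ℕ) :
    IsAlive u (actionHistory b n) ↔ ∀ k ≤ n, u (actionHistory b k) ≠ Decision.announce := by
  induction n with
  | zero => simp [actionHistory, IsAlive]
  | succ n ih =>
    simp only [actionHistory, IsAlive, ih]
    constructor
    · rintro ⟨h1, h2⟩ k hk
      rcases hk.eq_or_lt with rfl | hk
      · exact h1
      · exact h2 k (Nat.lt_succ_iff.1 hk)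
    · exact fun h => ⟨h (n + 1) le_rfl, fun k hk => h k (hk.trans n.le_succ)⟩

theorem stopsAt_actionHistory {A : Type*} (u : List A → Decision) (b : ℕ → A) (n : ℕ) :
    StopsAt u (actionHistory b n) ↔ u (actionHistory b n) = Decision.announce ∧
      ∀ k < n, u (actionHistory b k) ≠ Decision.announce := by
  cases n with
  | zero => simp [actionHistory, StopsAt]
  | succ n =>
    rw [actionHistory, StopsAt, isAlive_actionHistory]
    simp only [Nat.lt_succ_iff]

namespace QCDProtocol

variable {A Y Ω : Type*} [Fintype A] [DecidableEq A] [MeasurableSpace Y] [MeasurableSpace Ω]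
  {S : QCDProtocol A Y} {G : Fin 2 → A → ℝ} {π : Fin 2 → ℝ} {P : Measure Ω}
  {x : ℕ → Ω → Fin 2} {y : ℕ → Ω → Y} {a : ℕ → Ω → A}

theorem coe_lt_announceTime {u : List A → Decision} {ω : Ω} {n : ℕ} :
    (n : ℕ∞) < announceTime a u ω ↔ IsAlive u (actionHistory (fun k => a k ω) n) := by
  rw [announceTime, coe_lt_firstTime, isAlive_actionHistory]

theorem announceTime_eq_coe {u : List A → Decision} {ω : Ω} {n : ℕ} :
    announceTime a u ω = n ↔ StopsAt u (actionHistory (fun k => a k ω) n) := by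
  rw [announceTime, firstTime_eq_coe, stopsAt_actionHistory]

theorem changeTime_le_coe {ω : Ω} (h : ∀ n, x n ω = 0 → x (n + 1) ω = 0) {n : ℕ} :
    changeTime x ω ≤ n ↔ x n ω = 0 := by
  rw [changeTime, firstTime_le_coe]
  refine ⟨?_, fun hn => ⟨n, le_rfl, hn⟩⟩
  rintro ⟨k, hk, hx⟩
  induction n, hk using Nat.le_induction with
  | base => exact hx
  | succ n _ ih => exact h n ih

/-! ### The law of the state and the action history -/

namespace IsRealization

theorem measure_eq_add (hR : S.IsRealization π P x y a) (s : Set Ω) (l : ℕ) :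
    P s = P (s ∩ {ω | x l ω = 0}) + P (s ∩ {ω | x l ω = 1}) := by
  rw [← measure_inter_add_sdiff s (hR.measurableSet_state l 0)]
  congr 2
  ext ω
  simp only [Set.mem_sdiff, Set.mem_inter_iff, Set.mem_ofPred_eq, ← ne_eq,
    Fin.ne_zero_iff_eq_one_of_two]

/-- The likelihood of an action after a history, given the state. -/
noncomputable def stepLik (S : QCDProtocol A Y) (π : Fin 2 → ℝ) (h : List A) (b : A) (j : Fin 2) :
    ℝ≥0∞ :=
  ∫⁻ v, ENNReal.ofReal (S.humanAction (S.publicBelief π h) v b) * ENNReal.ofReal (S.B j v) ∂S.ν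

/-- The given law fixes the whole state path. The new factors depend only on the states at `n` and
`n + 1`, so earlier states are summed out one at a time. -/
theorem law_path (hR : S.IsRealization π P x y a) (b : ℕ → A) (n : ℕ) :
    ∀ l ≤ n, ∀ i : ℕ → Fin 2,
    P {ω | (∀ k, l ≤ k → k ≤ n + 1 → x k ω = i k) ∧ ∀ k < n + 1, a k ω = b k}
      = P {ω | (∀ k, l ≤ k → k ≤ n → x k ω = i k) ∧ ∀ k < n, a k ω = b k}
        * ENNReal.ofReal (S.trans (i n) (i (n + 1)))
        * stepLik S π (actionHistory b n) (b n) (i (n + 1)) := by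
  intro l
  induction l with
  | zero =>
    intro _ i
    simpa [stepLik] using hR.law_succ i (fun _ => Set.univ) b (fun _ => MeasurableSet.univ) n
  | succ l ih =>
    intro hl i
    have hset : ∀ (m N : ℕ), l ≤ m → ∀ v : Fin 2,
        {ω | (∀ k, l + 1 ≤ k → k ≤ m → x k ω = i k) ∧ ∀ k < N, a k ω = b k} ∩ {ω | x l ω = v}
        = {ω | (∀ k, l ≤ k → k ≤ m → x k ω = Function.update i l v k) ∧ ∀ k < N, a k ω = b k} := by
      intro m N hm v
      ext ω
      simp only [Set.mem_inter_iff, Set.mem_ofPred_eq]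
      constructor
      · rintro ⟨⟨h1, h2⟩, h3⟩
        refine ⟨fun k hk hkm => ?_, h2⟩
        rcases hk.eq_or_lt with rfl | hk
        · rw [Function.update_self, h3]
        · rw [Function.update_of_ne hk.ne', h1 k hk hkm]
      · rintro ⟨h1, h2⟩
        refine ⟨⟨fun k hk hkm => ?_, h2⟩, ?_⟩
        · rw [h1 k (by omega) hkm, Function.update_of_ne (by omega)]
        · rw [h1 l le_rfl hm, Function.update_self]
    rw [hR.measure_eq_add _ l, hset _ _ (by omega), hset _ _ (by omega), ih (by omega),
      ih (by omega), hR.measure_eq_add {ω | (∀ k, l + 1 ≤ k → k ≤ n → x k ω = i k) ∧ _} l,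
      hset _ _ (by omega), hset _ _ (by omega)]
    simp only [Function.update_of_ne (by omega : n ≠ l), Function.update_of_ne
      (by omega : n + 1 ≠ l)]
    rw [add_mul, add_mul]

theorem law_step (hR : S.IsRealization π P x y a) (b : ℕ → A) (n : ℕ) (j j' : Fin 2) :
    P {ω | (x n ω = j ∧ x (n + 1) ω = j') ∧ ∀ k < n + 1, a k ω = b k}
      = P {ω | x n ω = j ∧ ∀ k < n, a k ω = b k} * ENNReal.ofReal (S.trans j j')
        * stepLik S π (actionHistory b n) (b n) j' := by
  have h := hR.law_path b n n le_rfl (fun k => if k = n then j else j')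
  simp only [if_true, if_neg n.succ_ne_self] at h
  refine (congrArg P ?_).trans (h.trans (congrArg (fun s => P s * _ * _) ?_))
  · ext ω
    simp only [Set.mem_ofPred_eq]
    refine and_congr_left fun _ => ⟨fun h k hk hk' => ?_, fun h => ⟨?_, ?_⟩⟩
    · rcases hk.eq_or_lt with rfl | hk
      · rw [if_pos rfl, h.1]
      · obtain rfl : k = n + 1 := by omega
        rw [if_neg (by omega), h.2]
    · simpa using h n le_rfl (by omega)
    · simpa using h (n + 1) (by omega) le_rfl
  · ext ω
    simp only [Set.mem_ofPred_eq]
    refine and_congr_left fun _ => ⟨fun h => ?_, fun h k hk hk' => ?_⟩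
    · simpa using h n le_rfl le_rfl
    · obtain rfl : k = n := by omega
      rw [if_pos rfl, h]

theorem sum_ofReal_mul_trans {w : ℝ} (hw : 0 ≤ w) {η : Fin 2 → ℝ} (hη : ∀ i, 0 ≤ η i)
    (j : Fin 2) :
    ENNReal.ofReal (w * η 0) * ENNReal.ofReal (S.trans 0 j)
      + ENNReal.ofReal (w * η 1) * ENNReal.ofReal (S.trans 1 j)
      = ENNReal.ofReal w * ENNReal.ofReal (S.predict η j) := by
  have ht : ∀ i, 0 ≤ S.trans i j := by
    intro i
    have h1 := S.p_nonneg
    have h2 := S.p_lt_one.le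
    fin_cases i <;> fin_cases j <;> simp [trans, h1, h2]
  rw [← ENNReal.ofReal_mul (mul_nonneg hw (hη 0)), ← ENNReal.ofReal_mul (mul_nonneg hw (hη 1)),
    ← ENNReal.ofReal_mul hw, ← ENNReal.ofReal_add
      (mul_nonneg (mul_nonneg hw (hη 0)) (ht 0)) (mul_nonneg (mul_nonneg hw (hη 1)) (ht 1))]
  congr 1
  simp only [predict, Matrix.mulVec, dotProduct, Fin.sum_univ_two, Matrix.transpose_apply]
  ring

/-- The public belief is the conditional law of the state given the actions: prediction sums over
the previous state, and the observation integral is the Bayes update. -/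
theorem law_history (hR : S.IsRealization π P x y a) (hG : S.agent.IsActionKernel G)
    (hπ : π ∈ stdSimplex ℝ (Fin 2)) (b : ℕ → A) (n : ℕ) :
    ∀ j, P {ω | x n ω = j ∧ ∀ k < n, a k ω = b k} = S.historyMass π (actionHistory b n) j := by
  induction n with
  | zero =>
    intro j
    simpa [historyMass, historyProb, publicBelief, actionHistory] using hR.law_zero j
  | succ n ih =>
    intro j
    have hset : ∀ i, {ω | x (n + 1) ω = j ∧ ∀ k < n + 1, a k ω = b k} ∩ {ω | x n ω = i}
        = {ω | (x n ω = i ∧ x (n + 1) ω = j) ∧ ∀ k < n + 1, a k ω = b k} := by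
      intro i
      ext ω
      simp only [Set.mem_inter_iff, Set.mem_ofPred_eq]
      tauto
    rw [hR.measure_eq_add _ n, hset, hset, hR.law_step, hR.law_step, ih, ih, ← add_mul]
    simp only [historyMass, actionHistory, historyProb, publicBelief]
    obtain ⟨h1, h2⟩ := historyProb_nonneg_and_mem hG hπ (actionHistory b n)
    rcases eq_or_ne (S.historyProb π (actionHistory b n)) 0 with h0 | h0
    · simp [h0]
    · have hm := h2 h0
      rw [sum_ofReal_mul_trans h1 hm.1, mul_assoc, stepLik, ofReal_predict_mul_lintegral hG hm,
        ← ENNReal.ofReal_mul h1, mul_assoc]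

theorem measurableSet_history (hR : S.IsRealization π P x y a) (n : ℕ) (j : Fin 2) (h : List A) :
    MeasurableSet {ω | x n ω = j ∧ actionHistory (fun k => a k ω) n = h} := by
  obtain ⟨b₀⟩ := S.agent.nonempty_action
  by_cases hb : ∃ b : ℕ → A, actionHistory b n = h
  · obtain ⟨b, rfl⟩ := hb
    simp only [actionHistory_eq_iff]
    have : {ω | x n ω = j ∧ ∀ k < n, a k ω = b k}
        = {ω | x n ω = j} ∩ ⋂ k, ⋂ (_ : k < n), {ω | a k ω = b k} := by
      ext ω; simp
    rw [this]
    exact (hR.measurableSet_state n j).inter (MeasurableSet.iInter fun k =>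
      MeasurableSet.iInter fun _ => hR.measurableSet_action k _)
  · have : {ω | x n ω = j ∧ actionHistory (fun k => a k ω) n = h} = ∅ := by
      ext ω
      simp only [Set.mem_ofPred_eq, Set.mem_empty_iff_false, iff_false, not_and]
      exact fun _ h' => hb ⟨_, h'⟩
    rw [this]
    exact MeasurableSet.empty

theorem measure_history (hR : S.IsRealization π P x y a) (hG : S.agent.IsActionKernel G)
    (hπ : π ∈ stdSimplex ℝ (Fin 2)) (h : List A) (j : Fin 2) :
    P {ω | x h.length ω = j ∧ actionHistory (fun k => a k ω) h.length = h}
      = S.historyMass π h j := by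
  have := S.agent.nonempty_action
  obtain ⟨b, hb⟩ := exists_actionHistory_eq h
  have h1 := hR.law_history hG hπ b h.length j
  simp only [← actionHistory_eq_iff, hb] at h1
  exact h1

theorem ae_absorbed (hR : S.IsRealization π P x y a) :
    ∀ᵐ ω ∂P, ∀ n, x n ω = 0 → x (n + 1) ω = 0 := by
  rw [ae_all_iff]
  intro n
  -- The law is known only jointly with the actions, so the event is covered by countably many
  -- histories, each null because the transition out of state `0` has probability zero.
  have hsub : {ω | ¬ (x n ω = 0 → x (n + 1) ω = 0)} ⊆ ⋃ h : List A,
      {ω | (x n ω = 0 ∧ x (n + 1) ω = 1) ∧ actionHistory (fun k => a k ω) (n + 1) = h} := by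
    intro ω hω
    simp only [Set.mem_ofPred_eq, Classical.not_imp] at hω
    simp only [Set.mem_iUnion, Set.mem_ofPred_eq, exists_and_left, exists_eq', and_true]
    exact ⟨hω.1, (Fin.ne_zero_iff_eq_one_of_two _).1 hω.2⟩
  refine measure_mono_null hsub (measure_iUnion_null fun h => ?_)
  by_cases hb : ∃ b : ℕ → A, actionHistory b (n + 1) = h
  · obtain ⟨b, rfl⟩ := hb
    simp only [actionHistory_eq_iff]
    rw [hR.law_step]
    simp [trans]
  · convert measure_empty (μ := P)
    ext ω
    simp only [Set.mem_ofPred_eq, Set.mem_empty_iff_false, iff_false, not_and]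
    exact fun _ h' => hb ⟨_, h'⟩

/-- The Kolmogorov–Shiryaev cost is the sum of the stage costs over the histories. -/
theorem cost_eq (hR : S.IsRealization π P x y a) (hG : S.agent.IsActionKernel G)
    (hπ : π ∈ stdSimplex ℝ (Fin 2)) (u : List A → Decision) :
    S.cost P x a u = S.policyCost π u := by
  classical
  have hinj : ∀ ω, Function.Injective fun n => actionHistory (fun k => a k ω) n := by
    intro ω m n h
    have := congrArg List.length h
    simpa only [length_actionHistory] using this
  have hdelay : ∫⁻ ω, ((announceTime a u ω - changeTime x ω : ℕ∞) : ℝ≥0∞) ∂P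
      = ∑' h, if IsAlive u h then S.historyMass π h 0 else 0 := by
    have hpt : ∀ᵐ ω ∂P, ((announceTime a u ω - changeTime x ω : ℕ∞) : ℝ≥0∞)
        = ∑' h : List A, {ω | x h.length ω = 0 ∧ actionHistory (fun k => a k ω) h.length = h}.indicator
          (fun _ => if IsAlive u h then (1 : ℝ≥0∞) else 0) ω := by
      filter_upwards [hR.ae_absorbed] with ω hω
      rw [ENat.toENNReal_sub_eq_tsum]
      simp only [changeTime_le_coe hω, coe_lt_announceTime]
      -- Along a fixed outcome only its own histories contribute, one for each time.
      rw [← (hinj ω).tsum_eq (f := fun h : List A =>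
        {ω | x h.length ω = 0 ∧ actionHistory (fun k => a k ω) h.length = h}.indicator
          (fun _ => if IsAlive u h then (1 : ℝ≥0∞) else 0) ω)]
      · refine tsum_congr fun n => ?_
        simp [Set.indicator_apply, length_actionHistory, ite_and]
      · intro h hh
        rw [Function.mem_support] at hh
        have := Set.mem_of_indicator_ne_zero hh
        exact ⟨h.length, this.2⟩
    rw [lintegral_congr_ae hpt, lintegral_tsum fun h =>
      (measurable_const.indicator (hR.measurableSet_history _ _ _)).aemeasurable]
    refine tsum_congr fun h => ?_
    rw [lintegral_indicator_const (hR.measurableSet_history _ _ _), hR.measure_history hG hπ]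
    simp
  have halarm : P {ω | announceTime a u ω < changeTime x ω}
      = ∑' h, if StopsAt u h then S.historyMass π h 1 else 0 := by
    set T : List A → Set Ω := fun h => if StopsAt u h then
      {ω | x h.length ω = 1 ∧ actionHistory (fun k => a k ω) h.length = h} else ∅ with hT
    have hTmem : ∀ h ω, ω ∈ T h ↔ StopsAt u h ∧ x h.length ω = 1 ∧
        actionHistory (fun k => a k ω) h.length = h := by
      intro h ω
      by_cases hs : StopsAt u h <;> simp [hT, hs]
    have hae : {ω | announceTime a u ω < changeTime x ω} =ᵐ[P] ⋃ h, T h := by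
      filter_upwards [hR.ae_absorbed] with ω hω
      refine propext ?_
      change announceTime a u ω < changeTime x ω ↔ ω ∈ ⋃ h, T h
      simp only [Set.mem_iUnion, hTmem]
      constructor
      · intro h
        obtain ⟨n, hn⟩ := ENat.ne_top_iff_exists.1 h.ne_top
        refine ⟨actionHistory (fun k => a k ω) n, announceTime_eq_coe.1 hn.symm, ?_, ?_⟩
        · rw [length_actionHistory, ← Fin.ne_zero_iff_eq_one_of_two, Ne, ← changeTime_le_coe hω, not_le,
            hn]
          exact h
        · rw [length_actionHistory]
      · rintro ⟨h, h1, h2, h3⟩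
        rw [← h3] at h1
        rw [announceTime_eq_coe.2 h1, ← not_le, changeTime_le_coe hω, h2]
        exact one_ne_zero
    rw [measure_congr hae, measure_iUnion]
    · refine tsum_congr fun h => ?_
      by_cases hs : StopsAt u h
      · simp only [hT, hs, if_true]
        exact hR.measure_history hG hπ h 1
      · simp [hT, hs]
    · intro h h' hne
      rw [Function.onFun, Set.disjoint_left]
      intro ω h1 h2
      rw [hTmem] at h1 h2
      have e1 : announceTime a u ω = h.length := announceTime_eq_coe.2 (by rw [h1.2.2]; exact h1.1)
      have e2 : announceTime a u ω = h'.length :=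
        announceTime_eq_coe.2 (by rw [h2.2.2]; exact h2.1)
      have e3 : h.length = h'.length := by exact_mod_cast e1.symm.trans e2
      exact hne (by rw [← h1.2.2, e3, h2.2.2])
    · intro h
      by_cases hs : StopsAt u h
      · simp only [hT, hs, if_true]
        exact hR.measurableSet_history _ _ _
      · simp [hT, hs]
  rw [cost, hdelay, halarm, policyCost, ← ENNReal.tsum_mul_left, ← ENNReal.tsum_mul_left,
    ← ENNReal.tsum_add]
  refine tsum_congr fun h => ?_
  rw [stageCost]
  congr 1 <;> split_ifs <;> simp

end IsRealization

end QCDProtocol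

/-! ### Dynamic programming -/

namespace QCDProtocol

variable {A Y Ω : Type*} [Fintype A] [DecidableEq A] [MeasurableSpace Y] [MeasurableSpace Ω]
  {S : QCDProtocol A Y} {G : Fin 2 → A → ℝ} {π : Fin 2 → ℝ}

/-- The optimal cost over all policies. -/
noncomputable def optimalCost (S : QCDProtocol A Y) (π : Fin 2 → ℝ) : ℝ≥0∞ :=
  ⨅ u : List A → Decision, S.policyCost π u

/-- The cost of proceeding when the continuation costs are `V`. -/
noncomputable def proceedCost (S : QCDProtocol A Y) (V : (Fin 2 → ℝ) → ℝ≥0∞) (π : Fin 2 → ℝ) :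
    ℝ≥0∞ :=
  ENNReal.ofReal (S.d * π 0) + ∑ b, V (S.update π b) * ENNReal.ofReal (S.actionNorm π b)

theorem proceedCost_mono (hG : S.agent.IsActionKernel G) (hπ : π ∈ stdSimplex ℝ (Fin 2))
    {V V' : (Fin 2 → ℝ) → ℝ≥0∞} (h : ∀ π ∈ stdSimplex ℝ (Fin 2), V π ≤ V' π) :
    S.proceedCost V π ≤ S.proceedCost V' π := by
  refine add_le_add le_rfl (Finset.sum_le_sum fun b _ => ?_)
  by_cases hb : S.actionNorm π b = 0
  · simp [hb]
  · exact mul_le_mul_left (h _ (update_mem hG hπ hb)) _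

theorem sum_ofReal_actionNorm (hG : S.agent.IsActionKernel G) (hπ : π ∈ stdSimplex ℝ (Fin 2)) :
    ∑ b, ENNReal.ofReal (S.actionNorm π b) = 1 := by
  rw [← ENNReal.ofReal_sum_of_nonneg fun b _ => actionNorm_nonneg hG hπ b, sum_actionNorm hG hπ,
    ENNReal.ofReal_one]

theorem optimalCost_le_QAnnounce : S.optimalCost π ≤ S.QAnnounce π :=
  (iInf_le _ fun _ => Decision.announce).trans (policyCost_of_announce rfl).le

theorem proceedCost_le_policyCost (hG : S.agent.IsActionKernel G)
    (hπ : π ∈ stdSimplex ℝ (Fin 2)) {u : List A → Decision} (hu : u [] ≠ Decision.announce) :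
    S.proceedCost S.optimalCost π ≤ S.policyCost π u := by
  rw [policyCost_of_proceed hG hπ hu]
  exact add_le_add le_rfl (Finset.sum_le_sum fun b _ => mul_le_mul_left (iInf_le _ _) _)

/-- Nearly optimal policies, one for each first action, are glued into one policy that proceeds
first. -/
theorem optimalCost_le_proceedCost (hG : S.agent.IsActionKernel G)
    (hπ : π ∈ stdSimplex ℝ (Fin 2)) : S.optimalCost π ≤ S.proceedCost S.optimalCost π := by
  refine ENNReal.le_of_forall_pos_le_add fun ε hε _ => ?_
  have hex : ∀ b, ∃ u, S.policyCost (S.update π b) u ≤ S.optimalCost (S.update π b) + ε := by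
    intro b
    have hfin : S.optimalCost (S.update π b) ≠ ⊤ :=
      ne_top_of_le_ne_top ENNReal.ofReal_ne_top optimalCost_le_QAnnounce
    have hlt := ENNReal.lt_add_right hfin (ENNReal.coe_ne_zero.2 hε.ne')
    obtain ⟨u, hu⟩ := iInf_lt_iff.1 hlt
    exact ⟨u, hu.le⟩
  choose v hv using hex
  -- The last letter of the list is the first action; the rest is the history seen by the policy
  -- chosen for it.
  let u : List A → Decision := fun h =>
    if hne : h = [] then Decision.proceed else v (h.getLast hne) h.dropLast
  have hu : u [] ≠ Decision.announce := by simp [u]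
  have hub : ∀ b, (fun l => u (l ++ [b])) = v b := by
    intro b
    funext l
    simp [u]
  calc S.optimalCost π ≤ S.policyCost π u := iInf_le _ _
    _ = ENNReal.ofReal (S.d * π 0) + ∑ b, S.policyCost (S.update π b) (v b)
        * ENNReal.ofReal (S.actionNorm π b) := by
        rw [policyCost_of_proceed hG hπ hu]
        simp only [hub]
    _ ≤ ENNReal.ofReal (S.d * π 0) + ∑ b, (S.optimalCost (S.update π b) + ε)
        * ENNReal.ofReal (S.actionNorm π b) :=
        add_le_add le_rfl (Finset.sum_le_sum fun b _ => mul_le_mul_left (hv b) _)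
    _ = S.proceedCost S.optimalCost π + ε := by
        simp only [add_mul, Finset.sum_add_distrib, ← Finset.mul_sum,
          sum_ofReal_actionNorm hG hπ, mul_one, proceedCost, add_assoc]

/-- The optimal cost when an announcement has to be made within `n` steps. -/
noncomputable def horizonCost (S : QCDProtocol A Y) (G : Fin 2 → A → ℝ) (n : ℕ) (π : Fin 2 → ℝ) :
    ℝ≥0∞ :=
  ENNReal.ofReal (S.f * π 1 - gain S.overlap G S.p S.d S.f n (π 1))

theorem sum_actionNorm_mul_update (hG : S.agent.IsActionKernel G)
    (hπ : π ∈ stdSimplex ℝ (Fin 2)) : ∑ b, S.actionNorm π b * S.update π b 1 = S.p * π 1 := by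
  simp only [actionNorm_eq hG hπ, update_one hG hπ]
  exact sum_mixLik_mul_postWeight S.isOverlap_overlap hG.nonneg hG.sum_eq_one
    (S.predict_weight_mem_Icc hπ)

/-- By the martingale property the expected later announcement cost is `f p π(1)`, which leaves the
term `f (1 - p) r` of `proceedGain`. -/
theorem proceedCost_horizonCost (hG : S.agent.IsActionKernel G) (hπ : π ∈ stdSimplex ℝ (Fin 2))
    (n : ℕ) : S.proceedCost (S.horizonCost G n) π = ENNReal.ofReal
      (S.f * π 1 - proceedGain S.overlap G S.p S.d S.f (gain S.overlap G S.p S.d S.f n) (π 1)) := by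
  have hq := S.predict_weight_mem_Icc hπ
  have h0 : π 0 = 1 - π 1 := by
    have h := hπ.2
    rw [Fin.sum_univ_two] at h
    linarith
  have hnn : ∀ b, 0 ≤ S.f * S.update π b 1
      - gain S.overlap G S.p S.d S.f n (S.update π b 1) := by
    intro b
    rw [update_one hG hπ]
    exact sub_nonneg.2 (gain_le S.isOverlap_overlap hG.nonneg hG.sum_eq_one S.p_nonneg S.p_lt_one
      S.d_pos.le S.f_nonneg n _ (postWeight_mem_Icc S.isOverlap_overlap (hG.nonneg 0 b)
        (hG.nonneg 1 b) hq))
  simp only [proceedCost, horizonCost]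
  simp only [← ENNReal.ofReal_mul (hnn _)]
  rw [← ENNReal.ofReal_sum_of_nonneg fun b _ => mul_nonneg (hnn b) (actionNorm_nonneg hG hπ b),
    ← ENNReal.ofReal_add (mul_nonneg S.d_pos.le (hπ.1 0))
      (Finset.sum_nonneg fun b _ => mul_nonneg (hnn b) (actionNorm_nonneg hG hπ b))]
  congr 1
  have e : ∑ b, (S.f * S.update π b 1 - gain S.overlap G S.p S.d S.f n (S.update π b 1))
      * S.actionNorm π b = S.f * (S.p * π 1)
        - ∑ b, S.actionNorm π b * gain S.overlap G S.p S.d S.f n (S.update π b 1) := by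
    rw [← sum_actionNorm_mul_update hG hπ, Finset.mul_sum, ← Finset.sum_sub_distrib]
    exact Finset.sum_congr rfl fun b _ => by ring
  rw [e, h0, proceedGain]
  simp only [actionNorm_eq hG hπ, update_one hG hπ]
  ring

theorem horizonCost_succ (hG : S.agent.IsActionKernel G) (hπ : π ∈ stdSimplex ℝ (Fin 2)) (n : ℕ) :
    S.horizonCost G (n + 1) π = min (S.QAnnounce π) (S.proceedCost (S.horizonCost G n) π) := by
  rw [proceedCost_horizonCost hG hπ, QAnnounce, ← ENNReal.ofReal_min, horizonCost, gain,
    ← min_sub_sub_left, sub_zero]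

theorem optimalCost_le_horizonCost (hG : S.agent.IsActionKernel G) (n : ℕ) :
    ∀ π ∈ stdSimplex ℝ (Fin 2), S.optimalCost π ≤ S.horizonCost G n π := by
  induction n with
  | zero =>
    intro π _
    simpa [horizonCost, gain, QAnnounce] using optimalCost_le_QAnnounce (S := S) (π := π)
  | succ n ih =>
    intro π hπ
    rw [horizonCost_succ hG hπ]
    exact le_min optimalCost_le_QAnnounce
      ((optimalCost_le_proceedCost hG hπ).trans (proceedCost_mono hG hπ ih))

/-- A policy still running after `n` steps can be made to announce then. The additional false alarm
cost is at most `f` times the probability `p^n π(1)` that the change has not occurred. -/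
theorem horizonCost_le_truncCost_add (hG : S.agent.IsActionKernel G) (n : ℕ) :
    ∀ π ∈ stdSimplex ℝ (Fin 2), ∀ u : List A → Decision,
      S.horizonCost G n π ≤ S.truncCost n π u + ENNReal.ofReal (S.f * S.p ^ n * π 1) := by
  induction n with
  | zero =>
    intro π _ u
    simp [horizonCost, gain]
  | succ n ih =>
    intro π hπ u
    rw [horizonCost_succ hG hπ]
    by_cases hu : u [] = Decision.announce
    · rw [truncCost_succ_of_announce n hu]
      exact (min_le_left _ _).trans le_self_add
    · refine (min_le_right _ _).trans ?_
      have hc : 0 ≤ S.f * S.p ^ n := mul_nonneg S.f_nonneg (pow_nonneg S.p_nonneg n)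
      have hb : ∀ b, S.horizonCost G n (S.update π b) * ENNReal.ofReal (S.actionNorm π b)
          ≤ S.truncCost n (S.update π b) (fun l => u (l ++ [b]))
              * ENNReal.ofReal (S.actionNorm π b)
            + ENNReal.ofReal (S.f * S.p ^ n * (S.actionNorm π b * S.update π b 1)) := by
        intro b
        by_cases h0 : S.actionNorm π b = 0
        · simp [h0]
        · have hm := update_mem hG hπ h0
          refine (mul_le_mul_left (ih _ hm fun l => u (l ++ [b])) _).trans ?_
          rw [add_mul, ← ENNReal.ofReal_mul (mul_nonneg hc (hm.1 1)), mul_assoc (S.f * S.p ^ n),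
            mul_comm (S.update π b 1)]
      have hnn : ∀ b, 0 ≤ S.f * S.p ^ n * (S.actionNorm π b * S.update π b 1) := by
        intro b
        rw [actionNorm_mul_update hG hπ, actionLik_mul_predict hG hπ]
        exact mul_nonneg hc (postNum_nonneg hG hπ b 1)
      rw [truncCost_succ_of_proceed hG hπ n hu, proceedCost, add_assoc]
      refine add_le_add le_rfl ((Finset.sum_le_sum fun b _ => hb b).trans ?_)
      rw [Finset.sum_add_distrib, ← ENNReal.ofReal_sum_of_nonneg fun b _ => hnn b,
        ← Finset.mul_sum, sum_actionNorm_mul_update hG hπ, pow_succ]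
      refine add_le_add le_rfl (le_of_eq ?_)
      congr 1
      ring

theorem horizonCost_le_optimalCost_add (hG : S.agent.IsActionKernel G) (n : ℕ)
    (hπ : π ∈ stdSimplex ℝ (Fin 2)) :
    S.horizonCost G n π ≤ S.optimalCost π + ENNReal.ofReal (S.f * S.p ^ n) := by
  rw [optimalCost, ENNReal.iInf_add]
  refine le_iInf fun u => (horizonCost_le_truncCost_add hG n π hπ u).trans ?_
  refine add_le_add (truncCost_le_policyCost n) (ENNReal.ofReal_le_ofReal ?_)
  exact mul_le_of_le_one_right (mul_nonneg S.f_nonneg (pow_nonneg S.p_nonneg n))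
    (weight_mem_Icc hπ).2

theorem proceedCost_horizonCost_le (hG : S.agent.IsActionKernel G) (n : ℕ)
    (hπ : π ∈ stdSimplex ℝ (Fin 2)) :
    S.proceedCost (S.horizonCost G n) π
      ≤ S.proceedCost S.optimalCost π + ENNReal.ofReal (S.f * S.p ^ n) := by
  refine (proceedCost_mono hG hπ
    fun π hπ => horizonCost_le_optimalCost_add hG n hπ).trans (le_of_eq ?_)
  simp only [proceedCost, add_mul, Finset.sum_add_distrib, ← Finset.mul_sum,
    sum_ofReal_actionNorm hG hπ, mul_one, add_assoc]

/-- Announcing is at least as good as proceeding exactly when the pre-change probability is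
small. -/
theorem exists_threshold (hG : S.agent.IsActionKernel G) :
    ∃ s ∈ Set.Icc (0 : ℝ) 1, ∀ π ∈ stdSimplex ℝ (Fin 2),
      (π 1 ≤ s → S.QAnnounce π ≤ S.proceedCost S.optimalCost π) ∧
      (π 1 < s → S.QAnnounce π < S.proceedCost S.optimalCost π) ∧
      (s < π 1 → S.proceedCost S.optimalCost π < S.QAnnounce π) := by
  obtain ⟨s, hs, h⟩ := exists_gain_threshold S.isOverlap_overlap hG.nonneg hG.sum_eq_one
    S.p_nonneg S.p_lt_one S.d_pos.le S.f_nonneg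
  -- The gap `d (s - π 1)` does not depend on the horizon, so it survives the limit in which the
  -- error `f p^n` vanishes.
  have hle : ∀ π ∈ stdSimplex ℝ (Fin 2), π 1 ≤ s →
      ENNReal.ofReal (S.f * π 1 + S.d * (s - π 1)) ≤ S.proceedCost S.optimalCost π := by
    intro π hπ hr
    have hlim : Tendsto (fun n => S.proceedCost S.optimalCost π + ENNReal.ofReal (S.f * S.p ^ n))
        atTop (𝓝 (S.proceedCost S.optimalCost π + ENNReal.ofReal (S.f * 0))) :=
      tendsto_const_nhds.add (ENNReal.tendsto_ofReal
        ((tendsto_pow_atTop_nhds_zero_of_lt_one S.p_nonneg S.p_lt_one).const_mul S.f))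
    rw [mul_zero, ENNReal.ofReal_zero, add_zero] at hlim
    refine ge_of_tendsto' hlim fun n => ?_
    refine le_trans ?_ (proceedCost_horizonCost_le hG n hπ)
    rw [proceedCost_horizonCost hG hπ]
    refine ENNReal.ofReal_le_ofReal ?_
    have := (h (π 1) (weight_mem_Icc hπ)).1 hr n
    linarith
  refine ⟨s, hs, fun π hπ => ⟨fun hr => ?_, fun hr => ?_, fun hr => ?_⟩⟩
  · refine le_trans (ENNReal.ofReal_le_ofReal ?_) (hle π hπ hr)
    have := mul_nonneg S.d_pos.le (sub_nonneg.2 hr)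
    linarith
  · refine lt_of_lt_of_le ?_ (hle π hπ hr.le)
    have h1 := mul_pos S.d_pos (sub_pos.2 hr)
    have h2 := mul_nonneg S.f_nonneg (weight_mem_Icc hπ).1
    exact (ENNReal.ofReal_lt_ofReal_iff (by linarith)).2 (by linarith)
  -- One finite horizon with positive gain suffices, because the optimal continuation costs no more.
  · obtain ⟨n, hn⟩ := (h (π 1) (weight_mem_Icc hπ)).2 hr
    have h1 : proceedGain S.overlap G S.p S.d S.f (gain S.overlap G S.p S.d S.f n) (π 1)
        ≤ S.f * π 1 := (le_max_right 0 _).trans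
      (gain_le S.isOverlap_overlap hG.nonneg hG.sum_eq_one S.p_nonneg S.p_lt_one S.d_pos.le
        S.f_nonneg (n + 1) (π 1) (weight_mem_Icc hπ))
    refine (proceedCost_mono hG hπ (optimalCost_le_horizonCost hG n)).trans_lt ?_
    rw [proceedCost_horizonCost hG hπ, QAnnounce]
    exact (ENNReal.ofReal_lt_ofReal_iff (by linarith)).2 (by linarith)

variable {P : (Fin 2 → ℝ) → Measure Ω} {x : ℕ → Ω → Fin 2} {y : ℕ → Ω → Y} {a : ℕ → Ω → A}

theorem value_eq (hP : ∀ π ∈ stdSimplex ℝ (Fin 2), S.IsRealization π (P π) x y a)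
    (hG : S.agent.IsActionKernel G) (hπ : π ∈ stdSimplex ℝ (Fin 2)) :
    S.value P x a π = S.optimalCost π := by
  simp only [value, optimalCost, (hP π hπ).cost_eq hG hπ]

theorem QProceed_eq (hP : ∀ π ∈ stdSimplex ℝ (Fin 2), S.IsRealization π (P π) x y a)
    (hG : S.agent.IsActionKernel G) (hπ : π ∈ stdSimplex ℝ (Fin 2)) :
    S.QProceed P x a π = S.proceedCost S.optimalCost π := by
  refine congrArg _ (Finset.sum_congr rfl fun b _ => ?_)
  by_cases hb : S.actionNorm π b = 0
  · simp [hb]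
  · rw [value_eq hP hG (update_mem hG hπ hb)]

theorem stationary_snoc (μ : (Fin 2 → ℝ) → Decision) (b : A) :
    (fun l => S.stationary μ π (l ++ [b])) = S.stationary μ (S.update π b) := by
  funext l
  simp only [stationary, publicBelief_snoc]

/-- A policy that is greedy for the optimal cost is optimal. -/
theorem policyCost_stationary_le (hG : S.agent.IsActionKernel G) {μ : (Fin 2 → ℝ) → Decision}
    (h1 : ∀ π ∈ stdSimplex ℝ (Fin 2), μ π = Decision.announce → S.QAnnounce π ≤ S.optimalCost π)
    (h2 : ∀ π ∈ stdSimplex ℝ (Fin 2), μ π ≠ Decision.announce →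
      S.proceedCost S.optimalCost π ≤ S.optimalCost π) (hπ : π ∈ stdSimplex ℝ (Fin 2)) :
    S.policyCost π (S.stationary μ π) ≤ S.optimalCost π := by
  -- Costs are nonnegative, so bounding every truncated cost is enough and no terminal condition is
  -- needed.
  refine policyCost_le_of_truncCost_le fun n => ?_
  induction n generalizing π with
  | zero => simp [truncCost_zero]
  | succ n ih =>
    by_cases hμ : μ π = Decision.announce
    · rw [truncCost_succ_of_announce n hμ]
      exact h1 π hπ hμ
    · rw [truncCost_succ_of_proceed hG hπ n hμ]
      simp only [stationary_snoc]
      exact (proceedCost_mono hG hπ (V := fun π => S.truncCost n π (S.stationary μ π))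
        fun π hπ => ih hπ).trans (h2 π hπ hμ)

theorem optimalCost_eq_min (hG : S.agent.IsActionKernel G) (hπ : π ∈ stdSimplex ℝ (Fin 2)) :
    S.optimalCost π = min (S.QAnnounce π) (S.proceedCost S.optimalCost π) := by
  refine le_antisymm (le_min optimalCost_le_QAnnounce (optimalCost_le_proceedCost hG hπ))
    (le_iInf fun u => ?_)
  by_cases hu : u [] = Decision.announce
  · exact (min_le_left _ _).trans (policyCost_of_announce hu).ge
  · exact (min_le_right _ _).trans (proceedCost_le_policyCost hG hπ hu)

end QCDProtocol

/-! ### The threshold theorem -/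

theorem Decision.ne_announce_iff (u : Decision) : u ≠ announce ↔ u = proceed := by
  cases u <;> simp

open QCDProtocol in
theorem theorem1 {A Y Ω : Type*} [Fintype A] [DecidableEq A] [MeasurableSpace Y]
    [MeasurableSpace Ω] (S : QCDProtocol A Y) (P : (Fin 2 → ℝ) → Measure Ω)
    (x : ℕ → Ω → Fin 2) (y : ℕ → Ω → Y) (a : ℕ → Ω → A)
    (hP : ∀ π ∈ stdSimplex ℝ (Fin 2), S.IsRealization π (P π) x y a) :
    (∀ η ∈ stdSimplex ℝ (Fin 2), ∀ b : A,
      Tendsto (S.agent.actionProbAt η b) atTop (𝓝 (S.agent.steadyAction η b))) ∧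
    S.IsOptimal P x a (S.optimalPolicy P x a) ∧
    ∃ θ ∈ Set.Icc (0 : ℝ) 1,
      (∀ π ∈ stdSimplex ℝ (Fin 2),
        (π 0 < θ → S.optimalPolicy P x a π = Decision.proceed) ∧
        (θ ≤ π 0 → S.optimalPolicy P x a π = Decision.announce)) ∧
      ∀ μ : (Fin 2 → ℝ) → Decision, S.IsOptimal P x a μ →
        ∀ π ∈ stdSimplex ℝ (Fin 2),
          (π 0 < θ → μ π = Decision.proceed) ∧ (θ < π 0 → μ π = Decision.announce) := by
  obtain ⟨G, hG0, hG1, hGs⟩ := S.agent.exists_steadyAction_eq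
  have hG : S.agent.IsActionKernel G := ⟨hG0, hG1, fun η hη b => (hGs η hη b).1⟩
  obtain ⟨s, hs, h⟩ := exists_threshold hG
  have hsum : ∀ π ∈ stdSimplex ℝ (Fin 2), π 0 = 1 - π 1 := by
    intro π hπ
    have h := hπ.2
    rw [Fin.sum_univ_two] at h
    linarith
  have hproceed : ∀ π ∈ stdSimplex ℝ (Fin 2), s < π 1 →
      S.optimalPolicy P x a π = Decision.proceed := by
    intro π hπ hr
    rw [optimalPolicy, QProceed_eq hP hG hπ, if_neg (not_le.2 ((h π hπ).2.2 hr))]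
  have hannounce : ∀ π ∈ stdSimplex ℝ (Fin 2), π 1 ≤ s →
      S.optimalPolicy P x a π = Decision.announce := by
    intro π hπ hr
    rw [optimalPolicy, QProceed_eq hP hG hπ, if_pos ((h π hπ).1 hr)]
  -- The level `s` is in the pre-change probability `π 1 = 1 - π 0`, hence the threshold `1 - s` in
  -- `π 0`.
  refine ⟨fun η hη b => (hGs η hη b).2, fun π hπ => ?_, 1 - s,
    ⟨by linarith [hs.2], by linarith [hs.1]⟩, fun π hπ => ⟨fun hr => ?_, fun hr => ?_⟩,
    fun μ hμ π hπ => ⟨fun hr => ?_, fun hr => ?_⟩⟩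
  · rw [(hP π hπ).cost_eq hG hπ, value_eq hP hG hπ]
    refine le_antisymm (policyCost_stationary_le hG (fun π hπ hμ => ?_) (fun π hπ hμ => ?_) hπ)
      (iInf_le _ _)
    · rw [optimalPolicy, QProceed_eq hP hG hπ] at hμ
      split_ifs at hμ with hle
      rw [optimalCost_eq_min hG hπ, min_eq_left hle]
    · rw [optimalPolicy, QProceed_eq hP hG hπ] at hμ
      split_ifs at hμ with hle
      · exact absurd rfl hμ
      · exact (optimalCost_eq_min hG hπ ▸ (min_eq_right (not_le.1 hle).le).symm).le
  · exact hproceed π hπ (by linarith [hsum π hπ])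
  · exact hannounce π hπ (by linarith [hsum π hπ])
  -- A wrong first decision is already fatal: announcing here costs exactly `QAnnounce`, strictly
  -- more than proceeding optimally. In the next case, proceeding costs at least `proceedCost`,
  -- strictly more than announcing.
  · rw [← Decision.ne_announce_iff]
    intro hann
    have hopt := hμ π hπ
    rw [(hP π hπ).cost_eq hG hπ, value_eq hP hG hπ, policyCost_of_announce hann] at hopt
    have hlt := (h π hπ).2.2 (by linarith [hsum π hπ])
    exact absurd (hopt.le.trans (optimalCost_le_proceedCost hG hπ)) (not_le.2 hlt)
  · by_contra hne
    have hopt := hμ π hπ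
    rw [(hP π hπ).cost_eq hG hπ, value_eq hP hG hπ] at hopt
    have hlt := (h π hπ).2.1 (by linarith [hsum π hπ])
    have hge := proceedCost_le_policyCost hG hπ (u := S.stationary μ π) hne
    exact absurd (hge.trans (hopt.le.trans optimalCost_le_QAnnounce)) (not_le.2 hlt)
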